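/- **Proposition 5.1.** Let $n,N\ge 1$ be integers. Write $Q=[-1/2,1/2)^n$, let $B_R\subset\mathbb{R}^n$ be the closed ball of radius $R$ centered at the origin, and $\widehat f(\xi)=\int_{\mathbb{R}^n} e^{-ix\cdot\xi}f(x)\,dx$ (with the same normalization for the Fourier transform $\mathcal F$ on $(\mathbb{R}^n)^{N+1}$). For $0<q\le\infty$ let $$\|f\|_{(L^2,\ell^q)}=\Big\{\sum_{\nu\in\mathbb{Z}^n}\Big(\int_Q|f(x+\nu)|^2dx\Big)^{q/2}\Big\}^{1/q}$$ (supremum over $\nu$ if $q=\infty$), and let $$\|F\|_{L^2_{ul}((\mathbb{R}^n)^{N+1})}=\sup_{\nu\in(\mathbb{Z}^n)^{N+1}}\Big(\int_{Q^{N+1}}|F(z+\nu)|^2dz\Big)^{1/2}\in[0,\infty].$$ For a bounded continuous function $\sigma$ on $(\mathbb{R}^n)^{N+1}$ and Schwartz functions $f_1,\dots,f_N\in\mathcal S(\mathbb{R}^n)$ let $$T_\sigma(f_1,\dots,f_N)(x)=\frac1{(2\pi)^{Nn}}\int_{(\mathbb{R}^n)^N}e^{ix\cdot(\xi_1+\cdots+\xi_N)}\sigma(x,\xi_1,\dots,\xi_N)\prod_{j=1}^N\widehat{f_j}(\xi_j)\,d\xi_1\cdots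 d\xi_N,$$ and let $\|T_\sigma\|_{(L^2,\ell^{q_1})\times\cdots\times(L^2,\ell^{q_N})\to(L^2,\ell^r)}\in[0,\infty]$ be the smallest $A$ such that $\|T_\sigma(f_1,\dots,f_N)\|_{(L^2,\ell^r)}\le A\prod_{j=1}^N\|f_j\|_{(L^2,\ell^{q_j})}$ for all $f_j\in\mathcal S(\mathbb{R}^n)\cap(L^2,\ell^{q_j})$. Let $W:(\mathbb{R}^n)^N\to(0,\infty)$ be continuous and of moderate class, that is, there are $C_W,M>0$ such that $W(\xi+\eta)\le C_W\,W(\xi)\,(1+|\eta|^2)^{M/2}$ for all $\xi,\eta\in(\mathbb{R}^n)^N$. Suppose that the restriction of $W$ to $(\mathbb{Z}^n)^N$ belongs to the class $\mathcal B_N((\mathbb{Z}^n)^N)$, that is, there is $c\in(0,\infty)$ such that $$\sum_{\nu_1,\dots,\nu_N\in\mathbb{Z}^n}W(\nu_1,\dots,\nu_N)\,A_0(\nu_1+\cdots+\nu_N)\prod_{j=1}^NA_j(\nu_j)\le c\prod_{j=0}^N\|A_j\|_{\ell^2(\mathbb{Z}^n)}$$ for all nonnegative functions $A_0,\dots,A_N$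 on $\mathbb{Z}^n$. Let $q_1,\dots,q_N,r\in(0,\infty]$ with $\sum_{j=1}^N1/q_j=1/r$. Then there is a constant $C>0$, depending only on $n$, $N$, $W$, $q_1,\dots,q_N$ and $r$, such that for all $R_0,R_1,\dots,R_N\in[1,\infty)$ and every bounded continuous function $\sigma:(\mathbb{R}^n)^{N+1}\to\mathbb{C}$ whose (distributional) Fourier transform satisfies $\mathrm{supp}\,\mathcal F\sigma\subset B_{R_0}\times B_{R_1}\times\cdots\times B_{R_N}$, $$\|T_\sigma\|_{(L^2,\ell^{q_1})\times\cdots\times(L^2,\ell^{q_N})\to(L^2,\ell^r)}\le C\,R_0^{n/2}\Big(\prod_{j=1}^NR_j^{n/\min(2,q_j)}\Big)\big\|W(\xi_1,\dots,\xi_N)^{-1}\sigma(x,\xi_1,\dots,\xi_N)\big\|_{L^2_{ul}((\mathbb{R}^n)^{N+1})}.$$ -/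

import Mathlib

open MeasureTheory
open scoped ENNReal SchwartzMap

noncomputable section

/-- The Euclidean space `ℝⁿ`. -/
abbrev Rn (n : ℕ) : Type := EuclideanSpace ℝ (Fin n)

/-- The lattice `ℤⁿ`. -/
abbrev Zn (n : ℕ) : Type := Fin n → ℤ

/-- The space `(ℝⁿ)^(N+1)` of the variables `(x, (ξ₁, …, ξ_N))`, with Lebesgue measure. -/
abbrev SymbolSpace (n N : ℕ) : Type := Rn n × (Fin N → Rn n)

/-- A lattice point of `ℤⁿ` regarded as a point of `ℝⁿ`. -/
def latticePoint {n : ℕ} (ν : Zn n) : Rn n := WithLp.toLp 2 (fun i => (ν i : ℝ))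

/-- The unit cube `Q = [-1/2, 1/2)ⁿ`. -/
def unitCube (n : ℕ) : Set (Rn n) := {x | ∀ i, x i ∈ Set.Ico (-(1 / 2) : ℝ) (1 / 2)}

/-- The `ℓ^q` quasi-norm, `0 < q ≤ ∞`, of a family of elements of `[0, ∞]`. -/
def lqNorm {ι : Type*} (q : ℝ≥0∞) (a : ι → ℝ≥0∞) : ℝ≥0∞ :=
  if q = ∞ then ⨆ k, a k else (∑' k, a k ^ q.toReal) ^ (1 / q.toReal)

/-- The quasi-norm of the amalgam space `(L^p, ℓ^q)(ℝⁿ)`: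
the `ℓ^q` norm in `ν ∈ ℤⁿ` of the `L^p(Q)` norm in `x` of `f (x + ν)`. -/
def amalgamNorm {n : ℕ} (p q : ℝ≥0∞) (f : Rn n → ℂ) : ℝ≥0∞ :=
  lqNorm q fun ν : Zn n =>
    eLpNorm (fun x => f (x + latticePoint ν)) p (volume.restrict (unitCube n))

/-- The norm of the uniformly local space `L²_ul((ℝⁿ)^(N+1))`: the supremum over
`(ν₀, ν) ∈ (ℤⁿ)^(N+1)` of the `L²` norm of the translated function on the unit cube
`Q × Q^N = [-1/2, 1/2)^(n(N+1))`. -/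
def ulNorm {n N : ℕ} (F : SymbolSpace n N → ℂ) : ℝ≥0∞ :=
  ⨆ (ν₀ : Zn n) (ν : Fin N → Zn n),
    eLpNorm (fun z => F (z.1 + latticePoint ν₀, fun j => z.2 j + latticePoint (ν j))) 2
      (volume.restrict (unitCube n ×ˢ Set.pi Set.univ fun _ : Fin N => unitCube n))

/-- The class `𝓑_N((ℤⁿ)^N)` of nonnegative functions `V` on `(ℤⁿ)^N` for which there is a constant
`c ∈ (0, ∞)` with `∑ V(ν₁,…,ν_N) A₀(ν₁+⋯+ν_N) ∏ A_j(ν_j) ≤ c ∏_{j=0}^N ‖A_j‖_{ℓ²}`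
for all nonnegative functions `A₀, …, A_N` on `ℤⁿ`. -/
def ClassB {n N : ℕ} (V : (Fin N → Zn n) → ℝ) : Prop :=
  (∀ ν, 0 ≤ V ν) ∧
  ∃ c : ℝ, 0 < c ∧
    ∀ (A₀ : Zn n → NNReal) (A : Fin N → Zn n → NNReal),
      ∑' ν : Fin N → Zn n,
          ENNReal.ofReal (V ν) * (A₀ (∑ j, ν j) : ℝ≥0∞) * ∏ j, (A j (ν j) : ℝ≥0∞)
        ≤ ENNReal.ofReal c * (lqNorm 2 (fun μ => (A₀ μ : ℝ≥0∞)) *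
            ∏ j, lqNorm 2 (fun μ => (A j μ : ℝ≥0∞)))

/-- Functions of moderate class on `(ℝⁿ)^N`: continuous, positive, and
`F(ξ + η) ≤ C F(ξ) ⟨η⟩^M` for some constants `C, M > 0`, where `⟨η⟩ = (1 + |η₁|² + ⋯ + |η_N|²)^{1/2}`. -/
def IsModerate {n N : ℕ} (F : (Fin N → Rn n) → ℝ) : Prop :=
  Continuous F ∧ (∀ ξ, 0 < F ξ) ∧
  ∃ C M : ℝ, 0 < C ∧ 0 < M ∧
    ∀ ξ η : Fin N → Rn n, F (ξ + η) ≤ C * F ξ * Real.sqrt (1 + ∑ j, ‖η j‖ ^ 2) ^ M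

/-- The Fourier transform `f̂(ξ) = ∫ e^{-i x·ξ} f(x) dx` on `ℝⁿ`. -/
def hat {n : ℕ} (f : Rn n → ℂ) (ξ : Rn n) : ℂ :=
  ∫ x : Rn n, Complex.exp (-(Complex.I * (inner ℝ x ξ : ℝ))) * f x

/-- The Fourier transform on `(ℝⁿ)^(N+1)`, with the same normalization:
`φ̂(w) = ∫ e^{-i (w₀·z₀ + w₁·z₁ + ⋯ + w_N·z_N)} φ(z) dz`. -/
def symbolHat {n N : ℕ} (φ : SymbolSpace n N → ℂ) (w : SymbolSpace n N) : ℂ :=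
  ∫ z : SymbolSpace n N,
    Complex.exp (-(Complex.I * ((inner ℝ z.1 w.1 + ∑ j, inner ℝ (z.2 j) (w.2 j) : ℝ) : ℂ))) * φ z

/-- The Fourier transform `𝓕 σ` of a bounded continuous function `σ` on `(ℝⁿ)^(N+1)`, as a tempered
distribution: `⟨𝓕 σ, φ⟩ = ⟨σ, φ̂⟩ = ∫ σ(w) φ̂(w) dw` for Schwartz functions `φ`. -/
def fourierDistribution {n N : ℕ} (σ : SymbolSpace n N → ℂ) (φ : 𝓢(SymbolSpace n N, ℂ)) : ℂ :=
  ∫ w : SymbolSpace n N, σ w * symbolHat (fun z => φ z) w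

/-- The product `B_{R₀} × B_{R₁} × ⋯ × B_{R_N}` of closed balls of `ℝⁿ` centered at the origin. -/
def productBall {n N : ℕ} (R₀ : ℝ) (R : Fin N → ℝ) : Set (SymbolSpace n N) :=
  Metric.closedBall 0 R₀ ×ˢ Set.pi Set.univ fun j => Metric.closedBall 0 (R j)

/-- The multilinear pseudo-differential operator with symbol `σ`:
`T_σ(f₁,…,f_N)(x) = (2π)^{-Nn} ∫ e^{i x·(ξ₁+⋯+ξ_N)} σ(x,ξ₁,…,ξ_N) ∏ f̂_j(ξ_j) dξ₁⋯dξ_N`. -/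
def multPsiDO {n N : ℕ} (σ : SymbolSpace n N → ℂ) (f : Fin N → 𝓢(Rn n, ℂ)) (x : Rn n) : ℂ :=
  ((1 / (2 * Real.pi) ^ (N * n) : ℝ) : ℂ) *
    ∫ ξ : Fin N → Rn n,
      Complex.exp (Complex.I * (inner ℝ x (∑ j, ξ j) : ℝ)) * σ (x, ξ) *
        ∏ j, hat (fun y => f j y) (ξ j)

/-- The operator (quasi-)norm `‖T‖_{X₁ × ⋯ × X_N → Y}`: the smallest `A` such that
`‖T(f₁,…,f_N)‖_Y ≤ A ∏ ‖f_j‖_{X_j}` for all Schwartz functions `f_j ∈ X_j` (it is `∞` if no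
finite `A` exists). The spaces enter through their quasi-norms, which are `∞` off the space. -/
def multOpNorm {n N : ℕ} (X : Fin N → (Rn n → ℂ) → ℝ≥0∞) (Y : (Rn n → ℂ) → ℝ≥0∞)
    (T : (Fin N → 𝓢(Rn n, ℂ)) → Rn n → ℂ) : ℝ≥0∞ :=
  sInf {A : ℝ≥0∞ | ∀ f : Fin N → 𝓢(Rn n, ℂ), (∀ j, X j (fun y => f j y) < ∞) →
    Y (T f) ≤ A * ∏ j, X j (fun y => f j y)}

end

/-! The estimate is local in `x`. On the lattice cube at `ν`, `T_σ f` is tested against a Schwartz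
function `G` supported near that cube. The pairing `∫ G · T_σ f` is, up to a constant, `⟨𝓕σ, φ⟩`,
where `φ̂(x,ξ) = G(x) e^{ix·(ξ₁+⋯+ξ_N)} ∏ f̂_j(ξ_j)`; Fourier inversion gives `φ(w) = c ∫ G(x)
e^{ix·w₀} ∏ f_j(x + w_j) dx`. Only the values of `φ` near `B_{R₀} × ⋯ × B_{R_N}` matter. There each
`f_j` may be replaced by a cutoff `F_j` to a ball of radius about `R_j` around `ν`, and `φ` may be
multiplied by `Φ̂(w₀)` with `Φ̂ = 1` on a neighbourhood of `B_{R₀}`. After this replacement `φ̂`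
becomes the transform of `Φ(· - x) G` at `-(ξ₁+⋯+ξ_N)` times `∏ F̂_j(ξ_j)`
(`enorm_integral_mul_multPsiDO_le`).

The resulting absolute integral is cut into unit cubes in `(x,ξ)`. Cauchy–Schwarz on each cube
extracts the local `L²` norm of `σ`, at most a constant times `W(μ)` times the uniformly local norm.
The sum over the frequency cubes `μ` is then exactly of the form controlled by the class `𝓑_N`, with
`A_j` the local `L²` norms of `F̂_j` and `A₀` those of the transform of `Φ(· - x) G`. Plancherel
evaluates the `ℓ²` norms of `A_j`, `j ≥ 1`. That of `A₀` contributes `R₀^{n/2}`, since `Φ` is a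
dilate by `R₀`, together with decay in the distance from `ν` to the `x`-cube, so the `x`-cubes can
be summed (`exists_lintegral_mul_hat_le`). Duality yields `‖T_σ f‖_{L²(ν+Q)} ≲ R₀^{n/2}
‖W⁻¹σ‖_{L²_ul} ∏ ‖F_j‖_{L²}` (`exists_eLpNorm_multPsiDO_le`).

Taking `ℓ^r` norms in `ν`, Hölder's inequality separates the factors. Each `‖F_j‖_{L²}²` is a sum
over about `R_j^n` neighbouring cubes, which costs `R_j^{n/min(2,q_j)}` in `ℓ^{q_j}`
(`lqNorm_cutoff_le`). -/

noncomputable section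

/-! ### Fourier inversion and Plancherel in the normalization `e^{-ix·ξ}` -/

open scoped FourierTransform

/-- Multiplication by `2π` as a linear equivalence. -/
def twoPiEquiv (V : Type*) [NormedAddCommGroup V] [NormedSpace ℝ V] : V ≃L[ℝ] V :=
  ContinuousLinearEquiv.smulLeft (Units.mk0 (2 * Real.pi) (by positivity))

theorem twoPiEquiv_apply {V : Type*} [NormedAddCommGroup V] [NormedSpace ℝ V] (v : V) : twoPiEquiv V v = (2 * Real.pi) • v := rfl

theorem twoPiEquiv_symm_apply {V : Type*} [NormedAddCommGroup V] [NormedSpace ℝ V] (v : V) : (twoPiEquiv V).symm v = (2 * Real.pi)⁻¹ • v := by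
  rw [ContinuousLinearEquiv.symm_apply_eq, twoPiEquiv_apply, smul_smul,
    mul_inv_cancel₀ (by positivity), one_smul]

section FourierTransport

variable {S V : Type*} [NormedAddCommGroup S] [NormedSpace ℝ S] [MeasureSpace S] [BorelSpace S]
  [NormedAddCommGroup V] [InnerProductSpace ℝ V] [MeasurableSpace V] [BorelSpace V]
  [FiniteDimensional ℝ V] [(volume : Measure S).IsAddHaarMeasure]

/-- Uniqueness of Haar measure up to a positive factor; the value of the factor never matters below.
-/
theorem exists_integral_eq_integral_comp_symm (e : S ≃L[ℝ] V) :
    ∃ c : ℝ, 0 < c ∧ ∀ F : S → ℂ, ∫ z, F z = c * ∫ v : V, F (e.symm v) := by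
  have hmap := e.isAddHaarMeasure_map (volume : Measure S)
  have hs := Measure.isAddLeftInvariant_eq_smul (Measure.map e (volume : Measure S))
    (volume : Measure V)
  set a := Measure.addHaarScalarFactor (Measure.map e (volume : Measure S)) (volume : Measure V)
  have ha : a ≠ 0 := by
    intro h0
    rw [h0, zero_smul] at hs
    exact hmap.toIsOpenPosMeasure.open_pos Set.univ isOpen_univ Set.univ_nonempty (by simp [hs])
  refine ⟨a, by positivity, fun F => ?_⟩
  have h1 : ∫ z, F z = ∫ v, F (e.symm v) ∂(Measure.map e (volume : Measure S)) := by
    have he : MeasurableEmbedding e := e.toHomeomorph.measurableEmbedding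
    rw [he.integral_map (g := fun v => F (e.symm v))]
    simp
  rw [h1, hs, integral_smul_nnreal_measure]
  simp [NNReal.smul_def]

/-- `SymbolSpace` carries a supremum norm and no inner product, so its Fourier integrals are
transported to a Euclidean model `V`. The factor `(2π)⁻¹` converts the phase `e^{-ix·ξ}` to
`e^{-2πix·ξ}`. -/
theorem exists_transport_eq_schwartz_fourier (e : S ≃L[ℝ] V) :
    ∃ c : ℝ, 0 < c ∧ ∀ (φ : 𝓢(S, ℂ)) (w : S),
      ∫ z, Complex.exp (-(Complex.I * (inner ℝ (e z) (e w) : ℝ))) * φ z =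
        c * 𝓕 (SchwartzMap.compCLMOfContinuousLinearEquiv ℝ e.symm φ) ((2 * Real.pi)⁻¹ • e w) := by
  obtain ⟨c, hc, h⟩ := exists_integral_eq_integral_comp_symm e
  refine ⟨c, hc, fun φ w => ?_⟩
  rw [h, SchwartzMap.fourier_coe, Real.fourier_eq']
  congr 2
  ext v
  rw [SchwartzMap.compCLMOfContinuousLinearEquiv_apply, inner_smul_right, smul_eq_mul]
  have : (2 * Real.pi) * (2 * Real.pi)⁻¹ = 1 := mul_inv_cancel₀ (by positivity)
  have h2 : -2 * Real.pi * ((2 * Real.pi)⁻¹ * inner ℝ v (e w)) = - inner ℝ v (e w) := by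
    linear_combination (- inner ℝ v (e w)) * this
  simp only [h2, e.apply_symm_apply, Function.comp]
  push_cast
  ring_nf

theorem exists_schwartz_eq_fourier_integral (e : S ≃L[ℝ] V) (φ : 𝓢(S, ℂ)) :
    ∃ ψ : 𝓢(S, ℂ), ∀ w,
      ∫ z, Complex.exp (-(Complex.I * (inner ℝ (e z) (e w) : ℝ))) * φ z = ψ w := by
  obtain ⟨c, hc, h⟩ := exists_transport_eq_schwartz_fourier e
  refine ⟨(c : ℂ) • SchwartzMap.compCLMOfContinuousLinearEquiv ℝ (e.trans (twoPiEquiv V).symm)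
    (𝓕 (SchwartzMap.compCLMOfContinuousLinearEquiv ℝ e.symm φ)), fun w => ?_⟩
  rw [h]
  simp [twoPiEquiv_symm_apply]

/-- Surjectivity of the transform on Schwartz functions, with an explicit preimage: test functions
can be prescribed through their transforms and still be evaluated pointwise. -/
theorem exists_fourier_integral_inverse (e : S ≃L[ℝ] V) :
    ∃ c : ℝ, 0 < c ∧ ∀ θ : 𝓢(S, ℂ), ∃ φ : 𝓢(S, ℂ),
      (∀ w, ∫ z, Complex.exp (-(Complex.I * (inner ℝ (e z) (e w) : ℝ))) * φ z = θ w) ∧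
      ∀ w, φ w = c * ∫ z, Complex.exp (Complex.I * (inner ℝ (e z) (e w) : ℝ)) * θ z := by
  obtain ⟨c, hc, h⟩ := exists_transport_eq_schwartz_fourier e
  obtain ⟨c', hc', h'⟩ := exists_integral_eq_integral_comp_symm e
  set d := Module.finrank ℝ V
  refine ⟨c⁻¹ * c'⁻¹ * |((2 * Real.pi) ^ d)⁻¹|, by positivity, fun θ => ?_⟩
  set θ' := SchwartzMap.compCLMOfContinuousLinearEquiv ℝ ((twoPiEquiv V).trans e.symm) θ
  refine ⟨((c : ℂ)⁻¹) • SchwartzMap.compCLMOfContinuousLinearEquiv ℝ e (𝓕⁻ θ'), fun w => ?_,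
    fun w => ?_⟩
  · rw [h]
    have : SchwartzMap.compCLMOfContinuousLinearEquiv ℝ e.symm
        (((c : ℂ)⁻¹) • SchwartzMap.compCLMOfContinuousLinearEquiv ℝ e (𝓕⁻ θ'))
        = ((c : ℂ)⁻¹) • 𝓕⁻ θ' := by
      ext v; simp
    rw [this, FourierTransform.fourier_smul, FourierTransform.fourier_fourierInv_eq]
    have hc0 : (c : ℂ) ≠ 0 := by exact_mod_cast hc.ne'
    have h2 : (2 * Real.pi) • (2 * Real.pi)⁻¹ • e w = e w := by
      rw [smul_smul, mul_inv_cancel₀ (by positivity), one_smul]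
    simp only [smul_apply, smul_eq_mul, θ', Function.comp,
      SchwartzMap.compCLMOfContinuousLinearEquiv_apply, ContinuousLinearEquiv.trans_apply,
      twoPiEquiv_apply, h2, e.symm_apply_apply]
    field_simp
  · rw [h']
    have h3 := Measure.integral_comp_smul (volume : Measure V)
      (fun v => Complex.exp (Complex.I * (inner ℝ v (e w) : ℝ)) * θ (e.symm v)) (2 * Real.pi)
    simp only [smul_apply, smul_eq_mul, Function.comp, SchwartzMap.fourierInv_coe,
      SchwartzMap.compCLMOfContinuousLinearEquiv_apply, Real.fourierInv_eq', e.apply_symm_apply]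
    have h4 : ∫ v : V, Complex.exp (((2 * Real.pi * inner ℝ v (e w) : ℝ) : ℂ) * Complex.I) * θ' v
      = ∫ v : V, Complex.exp (Complex.I * (inner ℝ ((2 * Real.pi) • v) (e w) : ℝ)) *
        θ (e.symm ((2 * Real.pi) • v)) := by
      congr 1; ext v
      rw [inner_smul_left]
      simp [θ', twoPiEquiv_apply, mul_comm]
    rw [h4, h3]
    have hc0 : (c' : ℂ) ≠ 0 := by exact_mod_cast hc'.ne'
    simp only [Complex.real_smul]
    push_cast
    generalize (∫ x : V, Complex.exp (Complex.I * (inner ℝ x (e w) : ℝ)) * θ (e.symm x)) = J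
    rw [show Module.finrank ℝ V = d from rfl]
    field_simp

end FourierTransport

/-- The space of symbols with its Euclidean structure. -/
def symbolEquiv (n N : ℕ) :
    SymbolSpace n N ≃L[ℝ] WithLp 2 (Rn n × PiLp 2 (fun _ : Fin N => Rn n)) :=
  ((ContinuousLinearEquiv.refl ℝ (Rn n)).prodCongr
    (PiLp.continuousLinearEquiv 2 ℝ (fun _ : Fin N => Rn n)).symm).trans
    (WithLp.prodContinuousLinearEquiv 2 ℝ (Rn n) (PiLp 2 (fun _ : Fin N => Rn n))).symm

instance isAddHaarMeasure_volume_symbolSpace (n N : ℕ) :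
    (volume : Measure (SymbolSpace n N)).IsAddHaarMeasure :=
  haveI : (volume : Measure (Fin N → Rn n)).IsAddHaarMeasure :=
    inferInstanceAs (Measure.pi fun _ : Fin N => (volume : Measure (Rn n))).IsAddHaarMeasure
  inferInstanceAs ((volume : Measure (Rn n)).prod
    (volume : Measure (Fin N → Rn n))).IsAddHaarMeasure

/-- The pairing of two points of `(ℝⁿ)^(N+1)`. -/
def phase {n N : ℕ} (z w : SymbolSpace n N) : ℝ := inner ℝ z.1 w.1 + ∑ j, inner ℝ (z.2 j) (w.2 j)

theorem inner_symbolEquiv {n N : ℕ} (z w : SymbolSpace n N) :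
    inner ℝ (symbolEquiv n N z) (symbolEquiv n N w) = phase z w := by
  rw [WithLp.prod_inner_apply, PiLp.inner_apply]
  rfl

theorem symbolHat_eq {n N : ℕ} (φ : SymbolSpace n N → ℂ) (w : SymbolSpace n N) :
    symbolHat φ w = ∫ z, Complex.exp (-(Complex.I * (phase z w : ℝ))) * φ z := rfl

theorem exists_schwartz_eq_symbolHat {n N : ℕ} (φ : 𝓢(SymbolSpace n N, ℂ)) :
    ∃ ψ : 𝓢(SymbolSpace n N, ℂ), ∀ w, symbolHat (fun z => φ z) w = ψ w := by
  obtain ⟨ψ, h⟩ := exists_schwartz_eq_fourier_integral (symbolEquiv n N) φ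
  refine ⟨ψ, fun w => ?_⟩
  rw [← h, symbolHat_eq]
  simp only [inner_symbolEquiv]

theorem exists_symbolHat_inverse (n N : ℕ) :
    ∃ c : ℝ, 0 < c ∧ ∀ θ : 𝓢(SymbolSpace n N, ℂ), ∃ φ : 𝓢(SymbolSpace n N, ℂ),
      (∀ w, symbolHat (fun z => φ z) w = θ w) ∧
      ∀ w, φ w = c * ∫ z, Complex.exp (Complex.I * (phase z w : ℝ)) * θ z := by
  obtain ⟨c, hc, h⟩ := exists_fourier_integral_inverse (symbolEquiv n N)
  simp only [inner_symbolEquiv] at h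
  exact ⟨c, hc, h⟩

theorem exists_schwartz_eq_hat {n : ℕ} (f : 𝓢(Rn n, ℂ)) :
    ∃ g : 𝓢(Rn n, ℂ), ∀ ξ, hat (fun x => f x) ξ = g ξ :=
  exists_schwartz_eq_fourier_integral (ContinuousLinearEquiv.refl ℝ (Rn n)) f

theorem exists_hat_inverse (n : ℕ) :
    ∃ c : ℝ, 0 < c ∧ ∀ g : 𝓢(Rn n, ℂ), ∃ f : 𝓢(Rn n, ℂ),
      (∀ ξ, hat (fun x => f x) ξ = g ξ) ∧
      ∀ x, f x = c * ∫ ξ, Complex.exp (Complex.I * (inner ℝ ξ x : ℝ)) * g ξ :=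
  exists_fourier_integral_inverse (ContinuousLinearEquiv.refl ℝ (Rn n))

theorem hat_eq_fourier {n : ℕ} (f : 𝓢(Rn n, ℂ)) (ξ : Rn n) :
    hat (fun x => f x) ξ = 𝓕 f ((2 * Real.pi)⁻¹ • ξ) := by
  rw [SchwartzMap.fourier_coe, Real.fourier_eq', hat]
  congr 1
  ext v
  rw [inner_smul_right, smul_eq_mul]
  have : (2 * Real.pi) * (2 * Real.pi)⁻¹ = 1 := mul_inv_cancel₀ (by positivity)
  have h2 : -2 * Real.pi * ((2 * Real.pi)⁻¹ * inner ℝ v ξ) = - inner ℝ v ξ := by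
    linear_combination (- inner ℝ v ξ) * this
  simp only [h2]
  push_cast
  ring_nf

/-- Fourier inversion. -/
theorem exists_hat_inversion (n : ℕ) :
    ∃ c : ℝ, 0 < c ∧ ∀ (f : 𝓢(Rn n, ℂ)) (x : Rn n),
      ∫ ξ, Complex.exp (Complex.I * (inner ℝ ξ x : ℝ)) * hat (fun x => f x) ξ = c * f x := by
  refine ⟨|((2 * Real.pi)⁻¹ ^ Module.finrank ℝ (Rn n))⁻¹|, by positivity, fun f x => ?_⟩
  have h := Measure.integral_comp_smul (volume : Measure (Rn n))
      (fun v => Complex.exp (((2 * Real.pi * inner ℝ v x : ℝ) : ℂ) * Complex.I) * 𝓕 f v)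
      ((2 * Real.pi)⁻¹)
  have h1 := congrArg (fun g : 𝓢(Rn n, ℂ) => g x) (FourierTransform.fourierInv_fourier_eq (E := 𝓢(Rn n, ℂ)) (F := 𝓢(Rn n, ℂ)) f)
  simp only [SchwartzMap.fourierInv_coe, Real.fourierInv_eq', smul_eq_mul] at h1
  rw [h1, Complex.real_smul] at h
  rw [← h]
  congr 1; ext ξ
  rw [hat_eq_fourier, inner_smul_left]
  have : (2 * Real.pi) * ((2 * Real.pi)⁻¹ * inner ℝ ξ x) = inner ℝ ξ x := by
    rw [← mul_assoc, mul_inv_cancel₀ (by positivity), one_mul]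
  rw [RCLike.conj_to_real, this, mul_comm Complex.I]

/-- Plancherel's theorem. -/
theorem exists_lintegral_hat_sq (n : ℕ) :
    ∃ c : ℝ, 0 < c ∧ ∀ f : 𝓢(Rn n, ℂ),
      ∫⁻ ξ, ‖hat (fun x => f x) ξ‖ₑ ^ 2 = ENNReal.ofReal c * ∫⁻ x, ‖f x‖ₑ ^ 2 := by
  refine ⟨|((2 * Real.pi)⁻¹ ^ Module.finrank ℝ (Rn n))⁻¹|, by positivity, fun f => ?_⟩
  have key : ∀ g : 𝓢(Rn n, ℂ), ∫⁻ x, ‖g x‖ₑ ^ 2 = ENNReal.ofReal (∫ x, ‖g x‖ ^ 2) := by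
    intro g
    rw [ofReal_integral_eq_lintegral_ofReal]
    · congr 1; ext x
      rw [ENNReal.ofReal_pow (norm_nonneg _), ofReal_norm]
    · exact (g.memLp 2).integrable_norm_pow (by norm_num)
    · exact Filter.Eventually.of_forall fun x => by positivity
  obtain ⟨g, hg⟩ := exists_schwartz_eq_hat f
  have h := Measure.integral_comp_smul (volume : Measure (Rn n))
      (fun v => ‖𝓕 f v‖ ^ 2) ((2 * Real.pi)⁻¹)
  have h2 := key g
  simp only [← hg, hat_eq_fourier] at h2 ⊢
  rw [h2, h, SchwartzMap.integral_norm_sq_fourier, key f, smul_eq_mul,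
    ENNReal.ofReal_mul (abs_nonneg _)]

/-! ### Phases and products of Schwartz functions -/

section

variable {E F : Type*} [NormedAddCommGroup E] [NormedSpace ℝ E] [NormedAddCommGroup F]
  [NormedSpace ℝ F]

theorem hasTemperateGrowth_cexp_I : Function.HasTemperateGrowth
    (fun t : ℝ => Complex.exp (Complex.I * (t : ℂ))) := by
  refine ⟨(contDiff_const.mul Complex.ofRealCLM.contDiff).cexp, fun m => ⟨0, 1, fun t => ?_⟩⟩
  rw [norm_iteratedFDeriv_eq_norm_iteratedDeriv]
  have : ∀ k, iteratedDeriv k (fun t : ℝ => Complex.exp (Complex.I * (t : ℂ))) =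
      fun t : ℝ => Complex.I ^ k * Complex.exp (Complex.I * (t : ℂ)) := by
    intro k
    induction k with
    | zero => simp
    | succ k ih =>
      rw [iteratedDeriv_succ, ih]
      ext s
      have h0 : HasDerivAt (fun t : ℝ => Complex.I * (t : ℂ)) Complex.I s := by
        simpa using (Complex.ofRealCLM.hasDerivAt (x := s)).const_mul Complex.I
      rw [((h0.cexp).const_mul (Complex.I ^ k)).deriv]
      ring
  rw [this]
  simp [mul_comm Complex.I, Complex.norm_exp_ofReal_mul_I]

/-- The product of Schwartz functions of linear images which jointly control the norm. -/
theorem exists_schwartz_eq_prod {ι : Type*} [Fintype ι] (h : ι → 𝓢(F, ℂ)) (P : ι → E →L[ℝ] F)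
    (hP : ∀ z, ∃ i, ‖z‖ ≤ ‖P i z‖) : ∃ θ : 𝓢(E, ℂ), ∀ z, θ z = ∏ i, h i (P i z) := by
  classical
  have hsm : ∀ (i : ι), ContDiff ℝ (⊤ : ℕ∞) (fun z => h i (P i z)) := fun i =>
    ((h i).smooth ⊤).comp (P i).contDiff
  refine ⟨⟨fun z => ∏ i, h i (P i z), contDiff_prod fun i _ => hsm i, fun k m => ?_⟩, fun z => rfl⟩
  have hd : ∀ (i : ι) (l : ℕ) (z : E), ‖iteratedFDeriv ℝ l (fun z => h i (P i z)) z‖ ≤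
      ‖P i‖ ^ l * ‖iteratedFDeriv ℝ l (h i) (P i z)‖ := by
    intro i l z
    have := (P i).iteratedFDeriv_comp_right ((h i).smooth ⊤) z (i := l) (by exact_mod_cast le_top)
    rw [show (fun z => h i (P i z)) = (h i) ∘ (P i) from rfl, this]
    refine (ContinuousMultilinearMap.norm_compContinuousLinearMap_le _ _).trans ?_
    rw [Finset.prod_const, Finset.card_univ, Fintype.card_fin, mul_comm]
  have hb : ∀ (i : ι) (l k : ℕ), ∃ C : ℝ, ∀ z, ‖P i z‖ ^ k *
      ‖iteratedFDeriv ℝ l (fun z => h i (P i z)) z‖ ≤ C := by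
    intro i l k
    obtain ⟨C, hC⟩ := (h i).decay k l
    refine ⟨‖P i‖ ^ l * C, fun z => ?_⟩
    calc _ ≤ ‖P i z‖ ^ k * (‖P i‖ ^ l * ‖iteratedFDeriv ℝ l (h i) (P i z)‖) := by
          gcongr; exact hd i l z
      _ = ‖P i‖ ^ l * (‖P i z‖ ^ k * ‖iteratedFDeriv ℝ l (h i) (P i z)‖) := by ring
      _ ≤ _ := by gcongr; exact hC.2 _
  choose C hC using hb
  set B : ℝ := 1 + ∑ i, ∑ l ∈ Finset.range (m + 1), (|C i l 0| + |C i l k|)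
  have hB1 : 1 ≤ B := by
    have : 0 ≤ ∑ i, ∑ l ∈ Finset.range (m + 1), (|C i l 0| + |C i l k|) := by positivity
    linarith
  have hCB : ∀ i l, l ≤ m → |C i l 0| + |C i l k| ≤ B := by
    intro i l hl
    have h1 : |C i l 0| + |C i l k| ≤ ∑ l ∈ Finset.range (m + 1), (|C i l 0| + |C i l k|) :=
      Finset.single_le_sum (f := fun l => |C i l 0| + |C i l k|) (fun _ _ => by positivity)
        (Finset.mem_range.2 (by omega))
    have h2 := Finset.single_le_sum
      (f := fun i => ∑ l ∈ Finset.range (m + 1), (|C i l 0| + |C i l k|))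
      (fun _ _ => by positivity) (Finset.mem_univ i)
    linarith
  have hB0 : ∀ i l z, l ≤ m → ‖iteratedFDeriv ℝ l (fun z => h i (P i z)) z‖ ≤ B := by
    intro i l z hl
    have := hC i l 0 z
    rw [pow_zero, one_mul] at this
    linarith [hCB i l hl, le_abs_self (C i l 0), abs_nonneg (C i l k)]
  have hBk : ∀ i l z, l ≤ m →
      ‖P i z‖ ^ k * ‖iteratedFDeriv ℝ l (fun z => h i (P i z)) z‖ ≤ B := by
    intro i l z hl
    linarith [hC i l k z, hCB i l hl, le_abs_self (C i l k), abs_nonneg (C i l 0)]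
  refine ⟨∑ p ∈ (Finset.univ : Finset ι).sym m, ((p : Multiset ι).countPerms : ℝ) *
    B ^ Fintype.card ι, fun z => ?_⟩
  -- In the Leibniz expansion the factor `i₀` that dominates `‖z‖` absorbs the whole polynomial
  -- weight; every other factor only needs to be bounded.
  obtain ⟨i₀, hi₀⟩ := hP z
  have hle := norm_iteratedFDeriv_prod_le (u := (Finset.univ : Finset ι))
    (f := fun i z => h i (P i z)) (N := (⊤ : ℕ∞)) (fun i _ => hsm i) (x := z) (n := m)
    (by exact_mod_cast le_top)
  calc _ ≤ ‖P i₀ z‖ ^ k * ‖iteratedFDeriv ℝ m (fun z => ∏ i, h i (P i z)) z‖ := by gcongr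
    _ ≤ ‖P i₀ z‖ ^ k * (∑ p ∈ (Finset.univ : Finset ι).sym m, ((p : Multiset ι).countPerms : ℝ) *
        ∏ i, ‖iteratedFDeriv ℝ (Multiset.count i p) (fun z => h i (P i z)) z‖) := by gcongr
    _ ≤ _ := by
      rw [Finset.mul_sum]
      refine Finset.sum_le_sum fun p _ => ?_
      rw [mul_left_comm]
      gcongr
      have hcount : ∀ i, Multiset.count i (p : Multiset ι) ≤ m := fun i =>
        (Multiset.count_le_card _ _).trans p.2.le
      rw [← Finset.mul_prod_erase _ _ (Finset.mem_univ i₀), ← mul_assoc]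
      have : B ^ Fintype.card ι = B * ∏ _i ∈ Finset.univ.erase i₀, B := by
        rw [Finset.mul_prod_erase _ (fun _ => B) (Finset.mem_univ i₀)]
        simp
      rw [this]
      gcongr with i hi
      · exact hBk _ _ _ (hcount _)
      · exact hB0 _ _ _ (hcount _)

end

end

/-! ### Vanishing of the distribution `𝓕σ` on test functions supported off its support -/

noncomputable section

section Vanishing

variable {n N : ℕ} {σ : SymbolSpace n N → ℂ}

theorem phase_comm (z w : SymbolSpace n N) : phase z w = phase w z := by
  simp [phase, real_inner_comm]

theorem phase_add_right (z w w' : SymbolSpace n N) : phase z (w + w') = phase z w + phase z w' := by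
  simp only [phase, Prod.fst_add, Prod.snd_add, Pi.add_apply, inner_add_right,
    Finset.sum_add_distrib]
  ring

theorem phase_smul_right (z w : SymbolSpace n N) (a : ℝ) : phase z (a • w) = a * phase z w := by
  simp only [phase, Prod.smul_fst, Prod.smul_snd, Pi.smul_apply, inner_smul_right, mul_add,
    Finset.mul_sum]

theorem continuous_phase : Continuous fun p : SymbolSpace n N × SymbolSpace n N => phase p.1 p.2 := by
  unfold phase
  fun_prop

theorem norm_cexp_neg_I (t : ℝ) : ‖Complex.exp (-(Complex.I * (t : ℂ)))‖ = 1 := by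
  rw [show -(Complex.I * (t : ℂ)) = ((-t : ℝ) : ℂ) * Complex.I by push_cast; ring,
    Complex.norm_exp_ofReal_mul_I]

theorem norm_cexp_I (t : ℝ) : ‖Complex.exp (Complex.I * (t : ℂ))‖ = 1 := by
  rw [mul_comm, Complex.norm_exp_ofReal_mul_I]

theorem integrable_symbolHat_integrand (φ : 𝓢(SymbolSpace n N, ℂ)) (w : SymbolSpace n N) :
    Integrable fun z => Complex.exp (-(Complex.I * (phase z w : ℝ))) * φ z := by
  refine φ.integrable.bdd_mul (c := 1) ?_ (Filter.Eventually.of_forall fun z => ?_)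
  · have := continuous_phase (n := n) (N := N)
    refine Continuous.aestronglyMeasurable ?_
    have h : Continuous fun z => phase z w := this.comp (by fun_prop : Continuous fun z => (z, w))
    fun_prop
  · rw [norm_cexp_neg_I]

theorem integrable_mul_schwartz {S : Type*} [NormedAddCommGroup S] [NormedSpace ℝ S]
    [MeasureSpace S] [BorelSpace S] [FiniteDimensional ℝ S]
    [(volume : Measure S).IsAddHaarMeasure] {σ : S → ℂ} (hσ : Continuous σ)
    (hb : ∃ K : ℝ, ∀ z, ‖σ z‖ ≤ K) (ψ : 𝓢(S, ℂ)) :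
    Integrable fun w => σ w * ψ w := by
  obtain ⟨K, hK⟩ := hb
  exact ψ.integrable.bdd_mul hσ.aestronglyMeasurable (Filter.Eventually.of_forall hK)

theorem integrable_mul_symbolHat (hσ : Continuous σ) (hb : ∃ K : ℝ, ∀ z, ‖σ z‖ ≤ K)
    (φ : 𝓢(SymbolSpace n N, ℂ)) : Integrable fun w => σ w * symbolHat (fun z => φ z) w := by
  obtain ⟨ψ, hψ⟩ := exists_schwartz_eq_symbolHat φ
  simp only [hψ]
  exact integrable_mul_schwartz hσ hb ψ

theorem fourierDistribution_sum (hσ : Continuous σ) (hb : ∃ K : ℝ, ∀ z, ‖σ z‖ ≤ K) {ι : Type*}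
    (s : Finset ι) (φ : ι → 𝓢(SymbolSpace n N, ℂ)) :
    fourierDistribution σ (∑ i ∈ s, φ i) = ∑ i ∈ s, fourierDistribution σ (φ i) := by
  unfold fourierDistribution
  rw [← integral_finsetSum _ fun i _ => integrable_mul_symbolHat hσ hb (φ i)]
  congr 1
  ext w
  rw [← Finset.mul_sum]
  congr 1
  simp only [symbolHat_eq]
  rw [← integral_finsetSum _ fun i _ => integrable_symbolHat_integrand (φ i) w]
  congr 1
  ext z
  rw [← Finset.mul_sum]
  congr 1
  simp

/-- Every point off the support has a neighbourhood on which the distribution vanishes. Finitely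
many of these cover the compact support of `φ`, and a smooth partition of unity glues them. -/
theorem fourierDistribution_eq_zero_of_hasCompactSupport (hσ : Continuous σ)
    (hb : ∃ K : ℝ, ∀ z, ‖σ z‖ ≤ K) (φ : 𝓢(SymbolSpace n N, ℂ)) (hφ : HasCompactSupport φ)
    (hd : Disjoint (tsupport φ) (Distribution.dsupport (fourierDistribution σ))) :
    fourierDistribution σ φ = 0 := by
  have h1 : ∀ x ∈ tsupport φ, ∃ s : Set (SymbolSpace n N),
      Distribution.IsVanishingOn (fourierDistribution σ) s ∧ IsOpen s ∧ x ∈ s := fun x hx =>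
    (Distribution.notMem_dsupport_iff x).1 (Set.disjoint_left.1 hd hx)
  choose! U hU1 hU2 hU3 using h1
  obtain ⟨t, ht, htU⟩ := IsCompact.elim_nhds_subcover hφ U
    (fun x hx => (hU2 x hx).mem_nhds (hU3 x hx))
  obtain ⟨f, hf⟩ := SmoothPartitionOfUnity.exists_isSubordinate
    (modelWithCornersSelf ℝ (SymbolSpace n N)) (isClosed_tsupport φ)
    (fun i : t => U i) (fun i => hU2 _ (ht _ i.2)) (by
      intro x hx
      have := htU hx
      simp only [Set.mem_iUnion] at this ⊢
      obtain ⟨i, hi, hxi⟩ := this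
      exact ⟨⟨i, hi⟩, hxi⟩)
  have hfs : ∀ i, ContDiff ℝ (⊤ : ℕ∞) (fun z => ((f i z : ℝ) : ℂ) * φ z) := fun i =>
    (Complex.ofRealCLM.contDiff.comp (f i).contMDiff.contDiff).mul (φ.smooth ⊤)
  have hfc : ∀ i, HasCompactSupport (fun z => ((f i z : ℝ) : ℂ) * φ z) := fun i =>
    hφ.mul_left
  have hsum : φ = ∑ i, (hfc i).toSchwartzMap (hfs i) := by
    ext z
    have : (∑ i, (hfc i).toSchwartzMap (hfs i)) z = ∑ i, ((f i z : ℝ) : ℂ) * φ z := by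
      simp
    rw [this, ← Finset.sum_mul, ← Complex.ofReal_sum]
    by_cases hz : z ∈ tsupport φ
    · have h2 := f.sum_eq_one hz
      rw [finsum_eq_sum_of_fintype] at h2
      rw [h2]; simp
    · rw [image_eq_zero_of_notMem_tsupport hz, mul_zero]
  rw [hsum, fourierDistribution_sum hσ hb]
  refine Finset.sum_eq_zero fun i _ => hU1 _ (ht _ i.2) _ ?_
  refine subset_trans ?_ (hf i)
  refine closure_mono fun z hz => ?_
  simp only [Function.mem_support] at hz ⊢
  intro h0
  exact hz (by simp [h0])

/-- Multiplying the test function by `β̂(a ·)` averages `φ̂` over translates by `a • t`; a change of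
variable moves the translation onto `σ`. In this form the limit `a → 0` is a matter of dominated
convergence. -/
theorem fourierDistribution_mul_symbolHat (hσ : Continuous σ) (hb : ∃ K : ℝ, ∀ z, ‖σ z‖ ≤ K)
    (φ β φ' : 𝓢(SymbolSpace n N, ℂ)) (a : ℝ)
    (h : ∀ z, φ' z = symbolHat (fun t => β t) (a • z) * φ z) :
    fourierDistribution σ φ' =
      ∫ t, β t * ∫ w, σ (w - a • t) * symbolHat (fun z => φ z) w := by
  obtain ⟨ψ, hψ⟩ := exists_schwartz_eq_symbolHat φ
  have hph := continuous_phase (n := n) (N := N)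
  have h1 : ∀ w, symbolHat (fun z => φ' z) w = ∫ t, β t * ψ (w + a • t) := by
    intro w
    simp only [← hψ]
    have : ∀ z, Complex.exp (-(Complex.I * (phase z w : ℝ))) * φ' z =
        ∫ t, β t * (Complex.exp (-(Complex.I * (phase z (w + a • t) : ℝ))) * φ z) := by
      intro z
      rw [h, symbolHat_eq, mul_comm _ (φ z), ← mul_assoc, ← integral_const_mul]
      congr 1; ext t
      rw [phase_add_right, phase_smul_right, phase_smul_right, phase_comm t z]
      push_cast
      rw [mul_add, neg_add, Complex.exp_add]
      ring
    rw [symbolHat_eq]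
    simp only [this]
    rw [integral_integral_swap]
    · simp only [symbolHat_eq, integral_const_mul]
    · have h2 : Integrable (fun p : SymbolSpace n N × SymbolSpace n N => φ p.1 * β p.2)
        (volume.prod volume) := φ.integrable.mul_prod β.integrable
      refine (h2.bdd_mul (c := 1) (f := fun p => Complex.exp
        (-(Complex.I * (phase p.1 (w + a • p.2) : ℝ)))) ?_ ?_).congr ?_
      · refine Continuous.aestronglyMeasurable ?_
        have : Continuous fun p : SymbolSpace n N × SymbolSpace n N => phase p.1 (w + a • p.2) :=
          hph.comp (by fun_prop : Continuous fun p : SymbolSpace n N × SymbolSpace n N =>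
            (p.1, w + a • p.2))
        fun_prop
      · exact Filter.Eventually.of_forall fun p => (norm_cexp_neg_I _).le
      · refine Filter.Eventually.of_forall fun p => ?_
        simp only [Function.uncurry]
        ring
  obtain ⟨K, hK⟩ := hb
  unfold fourierDistribution
  have hβψ : Integrable (fun p : SymbolSpace n N × SymbolSpace n N => β p.2 * ψ (p.1 + a • p.2))
      (volume.prod volume) := by
    rw [integrable_prod_iff' (by
      have h5 := β.continuous
      have h6 := ψ.continuous
      exact Continuous.aestronglyMeasurable (by fun_prop))]
    refine ⟨Filter.Eventually.of_forall fun t =>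
      (ψ.integrable.comp_add_right (a • t)).const_mul (β t), ?_⟩
    simp only [norm_mul, integral_const_mul]
    have h7 : ∀ t, ∫ w, ‖ψ (w + a • t)‖ = ∫ w, ‖ψ w‖ := fun t =>
      integral_add_right_eq_self (fun w => ‖ψ w‖) (a • t)
    simp only [h7]
    exact β.integrable.norm.mul_const _
  simp only [h1, hψ, ← integral_const_mul]
  rw [integral_integral_swap]
  · congr 1; ext t
    rw [← integral_add_right_eq_self (fun w => β t * (σ (w - a • t) * ψ w)) (a • t)]
    congr 1; ext w
    rw [add_sub_cancel_right]; ring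
  · exact hβψ.bdd_mul (f := fun p => σ p.1) (by fun_prop) (Filter.Eventually.of_forall fun p => hK p.1)

/-- Removes the compactness of the support: the truncations `b(a z) φ(z)` are annihilated for `a ≠
0`, and their pairings with `σ` converge to that of `φ` as `a → 0`, because `σ` is bounded and
continuous. -/
theorem fourierDistribution_eq_zero (hσ : Continuous σ)
    (hb : ∃ K : ℝ, ∀ z, ‖σ z‖ ≤ K) (φ : 𝓢(SymbolSpace n N, ℂ))
    (hd : Disjoint (tsupport φ) (Distribution.dsupport (fourierDistribution σ))) :
    fourierDistribution σ φ = 0 := by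
  let b : ContDiffBump (0 : SymbolSpace n N) := ⟨1, 2, by norm_num, by norm_num⟩
  have hbs : ContDiff ℝ (⊤ : ℕ∞) (fun z => ((b z : ℝ) : ℂ)) :=
    Complex.ofRealCLM.contDiff.comp b.contDiff
  have hbc : HasCompactSupport (fun z => ((b z : ℝ) : ℂ)) :=
    b.hasCompactSupport.comp_left (g := fun r : ℝ => (r : ℂ)) (by simp)
  obtain ⟨c, -, hc⟩ := exists_symbolHat_inverse n N
  obtain ⟨β, hβ, -⟩ := hc (hbc.toSchwartzMap hbs)
  replace hβ : ∀ w, symbolHat (fun z => β z) w = (b w : ℂ) := fun w => (hβ w).trans (by simp)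
  have hsm : ∀ a : ℝ, ContDiff ℝ (⊤ : ℕ∞) (fun z => ((b (a • z) : ℝ) : ℂ) * φ z) := fun a =>
    (hbs.comp (contDiff_const_smul a)).mul (φ.smooth ⊤)
  have hcs : ∀ a : ℝ, a ≠ 0 → HasCompactSupport (fun z => ((b (a • z) : ℝ) : ℂ) * φ z) := by
    intro a ha
    have := hbc.comp_smul ha
    exact this.mul_right
  have hzero : ∀ a : ℝ, a ≠ 0 →
      ∫ t, β t * ∫ w, σ (w - a • t) * symbolHat (fun z => φ z) w = 0 := by
    intro a ha
    rw [← fourierDistribution_mul_symbolHat hσ hb φ β ((hcs a ha).toSchwartzMap (hsm a)) a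
      (fun z => by simp [hβ])]
    refine fourierDistribution_eq_zero_of_hasCompactSupport hσ hb _ (hcs a ha) ?_
    refine hd.mono_left (closure_mono fun z hz => ?_)
    simp only [Function.mem_support] at hz ⊢
    intro h0
    exact hz (by simp [h0])
  obtain ⟨ψ, hψ⟩ := exists_schwartz_eq_symbolHat φ
  obtain ⟨K, hK⟩ := hb
  have hJ : Continuous fun s => ∫ w, σ (w - s) * ψ w := by
    refine continuous_of_dominated (bound := fun w => K * ‖ψ w‖) (fun s => ?_)
      (fun s => Filter.Eventually.of_forall fun w => ?_) (ψ.integrable.norm.const_mul K)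
      (Filter.Eventually.of_forall fun w => ?_)
    · exact Continuous.aestronglyMeasurable (by have := ψ.continuous; fun_prop)
    · rw [norm_mul]; gcongr; exact hK _
    · fun_prop
  have hJb : ∀ s, ‖∫ w, σ (w - s) * ψ w‖ ≤ K * ∫ w, ‖ψ w‖ := by
    intro s
    rw [← integral_const_mul]
    refine norm_integral_le_of_norm_le (ψ.integrable.norm.const_mul K)
      (Filter.Eventually.of_forall fun w => ?_)
    rw [norm_mul]; gcongr; exact hK _
  simp only [hψ] at hzero
  have hlim : Filter.Tendsto (fun k : ℕ => ∫ t, β t * ∫ w, σ (w - ((k : ℝ) + 1)⁻¹ • t) * ψ w)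
      Filter.atTop (nhds (∫ t, β t * ∫ w, σ (w - (0 : ℝ) • t) * ψ w)) := by
    refine tendsto_integral_of_dominated_convergence (fun t => ‖β t‖ * (K * ∫ w, ‖ψ w‖))
      (fun k => ?_) (β.integrable.norm.mul_const _)
      (fun k => Filter.Eventually.of_forall fun t => ?_)
      (Filter.Eventually.of_forall fun t => ?_)
    · exact (β.continuous.mul (hJ.comp (by fun_prop :
        Continuous fun t : SymbolSpace n N => ((k : ℝ) + 1)⁻¹ • t))).aestronglyMeasurable
    · rw [norm_mul]; gcongr; exact hJb _
    · refine Filter.Tendsto.const_mul _ ?_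
      refine (hJ.tendsto ((0 : ℝ) • t)).comp ?_
      exact (tendsto_inv_atTop_zero.comp
        (Filter.tendsto_atTop_add_const_right _ 1 tendsto_natCast_atTop_atTop)).smul_const t
  have h0 : ∫ t, β t * ∫ w, σ (w - (0 : ℝ) • t) * ψ w = 0 := by
    refine tendsto_nhds_unique hlim ?_
    simp only [fun k : ℕ => hzero ((k : ℝ) + 1)⁻¹ (by positivity)]
    exact tendsto_const_nhds
  simp only [zero_smul, sub_zero, integral_mul_const] at h0
  -- The total mass of `β` is its transform at the origin, which is `b 0 = 1`.
  have hβ1 : ∫ t, β t = 1 := by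
    have := hβ 0
    rw [symbolHat_eq] at this
    have h1 : b (0 : SymbolSpace n N) = 1 := b.one_of_mem_closedBall (by simp [b])
    simpa [phase, h1] using this
  rw [hβ1, one_mul] at h0
  unfold fourierDistribution
  simpa only [hψ] using h0

end Vanishing

end

/-! ### Localization of the pairing of `T_σ f` with a test function -/

noncomputable section

section Localization

variable {n N : ℕ}

theorem exists_schwartz_eq_modulated_tensor (G : 𝓢(Rn n, ℂ)) (f : Fin N → 𝓢(Rn n, ℂ)) :
    ∃ θ : 𝓢(SymbolSpace n N, ℂ), ∀ z, θ z =
      G z.1 * Complex.exp (Complex.I * (inner ℝ z.1 (∑ j, z.2 j) : ℝ)) *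
        ∏ j, hat (fun y => f j y) (z.2 j) := by
  choose g hg using fun j => exists_schwartz_eq_hat (f j)
  -- The index `none` stands for the variable `x` and `some j` for `ξ_j`. Under the supremum norm,
  -- one of these coordinates attains `‖z‖`.
  let P : Option (Fin N) → SymbolSpace n N →L[ℝ] Rn n := fun i =>
    i.elim (ContinuousLinearMap.fst ℝ _ _)
      (fun j => (ContinuousLinearMap.proj j).comp (ContinuousLinearMap.snd ℝ _ _))
  obtain ⟨θ, hθ⟩ := exists_schwartz_eq_prod (fun i : Option (Fin N) => i.elim G g) P (by
    intro z
    by_cases h : ‖z‖ ≤ ‖z.1‖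
    · exact ⟨none, h⟩
    · by_contra hcon
      push Not at hcon h
      have h2 : ‖z.2‖ < ‖z‖ :=
        (pi_norm_lt_iff ((norm_nonneg _).trans_lt h)).2 fun j => hcon (some j)
      exact absurd (Prod.norm_def (x := z)) (by
        have := max_lt h h2
        exact this.ne'))
  have hgrow : Function.HasTemperateGrowth (fun z : SymbolSpace n N =>
      Complex.exp (Complex.I * (inner ℝ z.1 (∑ j, z.2 j) : ℝ))) := by
    refine hasTemperateGrowth_cexp_I.comp ?_
    refine (innerSL ℝ).bilinear_hasTemperateGrowth (𝕜 := ℝ)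
      (ContinuousLinearMap.fst ℝ (Rn n) (Fin N → Rn n)).hasTemperateGrowth ?_
    have : (fun z : SymbolSpace n N => ∑ j, z.2 j) =
        ((∑ j, ContinuousLinearMap.proj j).comp (ContinuousLinearMap.snd ℝ (Rn n) (Fin N → Rn n)) :
          SymbolSpace n N →L[ℝ] Rn n) := by
      ext z; simp
    rw [this]
    exact ContinuousLinearMap.hasTemperateGrowth _
  refine ⟨SchwartzMap.smulLeftCLM ℂ (fun z : SymbolSpace n N =>
      Complex.exp (Complex.I * (inner ℝ z.1 (∑ j, z.2 j) : ℝ))) θ, fun z => ?_⟩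
  rw [SchwartzMap.smulLeftCLM_apply_apply hgrow, hθ, Fintype.prod_option, smul_eq_mul]
  simp only [Option.elim, P, hg]
  change _ * (G z.1 * ∏ j, g j (z.2 j)) = _
  ring

/-- Integrating in `ξ` first, the phase splits over `j` and each `ξ_j`-integral is the inversion
formula for `f_j` at `x + w_j`. The formula for `φ` shows which values of `f_j` are seen near a
given `w`. -/
theorem exists_modulated_tensor_inverse (n N : ℕ) :
    ∃ c : ℝ, 0 < c ∧ ∀ (G : 𝓢(Rn n, ℂ)) (f : Fin N → 𝓢(Rn n, ℂ)),
      ∃ φ : 𝓢(SymbolSpace n N, ℂ),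
        (∀ w, symbolHat (fun z => φ z) w =
          G w.1 * Complex.exp (Complex.I * (inner ℝ w.1 (∑ j, w.2 j) : ℝ)) *
            ∏ j, hat (fun y => f j y) (w.2 j)) ∧
        ∀ w, φ w = c * ∫ x, G x * Complex.exp (Complex.I * (inner ℝ x w.1 : ℝ)) *
          ∏ j, f j (x + w.2 j) := by
  obtain ⟨c, hc, h⟩ := exists_symbolHat_inverse n N
  obtain ⟨c', hc', h'⟩ := exists_hat_inversion n
  refine ⟨c * c' ^ N, by positivity, fun G f => ?_⟩
  obtain ⟨θ, hθ⟩ := exists_schwartz_eq_modulated_tensor G f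
  obtain ⟨φ, hφ1, hφ2⟩ := h θ
  refine ⟨φ, fun w => by rw [hφ1, hθ], fun w => ?_⟩
  rw [hφ2]
  push_cast
  rw [mul_assoc]
  congr 1
  have hint : Integrable (fun z => Complex.exp (Complex.I * (phase z w : ℝ)) * θ z)
      ((volume : Measure (Rn n)).prod (volume : Measure (Fin N → Rn n))) := by
    refine integrable_mul_schwartz (σ := fun z => Complex.exp (Complex.I * (phase z w : ℝ))) ?_
      ⟨1, fun z => (norm_cexp_I _).le⟩ θ
    have : Continuous fun z => phase z w :=
      (continuous_phase (n := n) (N := N)).comp (by fun_prop : Continuous fun z => (z, w))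
    fun_prop
  rw [Measure.volume_eq_prod, integral_prod _ hint, ← integral_const_mul]
  congr 1
  ext x
  have : ∀ ξ : Fin N → Rn n, Complex.exp (Complex.I * (phase (x, ξ) w : ℝ)) * θ (x, ξ) =
      (G x * Complex.exp (Complex.I * (inner ℝ x w.1 : ℝ))) *
        ∏ j, (Complex.exp (Complex.I * (inner ℝ (ξ j) (x + w.2 j) : ℝ)) *
          hat (fun y => f j y) (ξ j)) := by
    intro ξ
    rw [hθ, Finset.prod_mul_distrib, ← Complex.exp_sum]
    simp only [phase, inner_add_right, inner_sum]
    have h1 : ∑ i, Complex.I * ((inner ℝ (ξ i) x + inner ℝ (ξ i) (w.2 i) : ℝ) : ℂ) =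
      Complex.I * ((∑ i, inner ℝ (ξ i) x : ℝ) : ℂ) +
        Complex.I * ((∑ i, inner ℝ (ξ i) (w.2 i) : ℝ) : ℂ) := by
      push_cast
      rw [← Finset.mul_sum, Finset.sum_add_distrib, mul_add]
    rw [h1, Complex.exp_add]
    simp only [real_inner_comm x]
    push_cast
    rw [mul_add, Complex.exp_add]
    ring
  simp only [this]
  rw [integral_const_mul]
  rw [integral_fintype_prod_volume_eq_prod (fun j (ξ : Rn n) =>
    Complex.exp (Complex.I * (inner ℝ ξ (x + w.2 j) : ℝ)) * hat (fun y => f j y) ξ)]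
  simp only [h', Finset.prod_mul_distrib, Finset.prod_const, Finset.card_univ, Fintype.card_fin]
  ring

theorem exists_schwartz_hat_mul (Φ : 𝓢(Rn n, ℂ)) (φ : 𝓢(SymbolSpace n N, ℂ)) :
    ∃ φ' : 𝓢(SymbolSpace n N, ℂ), (∀ z, φ' z = hat (fun y => Φ y) z.1 * φ z) ∧
      ∀ w, symbolHat (fun z => φ' z) w =
        ∫ y, Φ y * symbolHat (fun z => φ z) (w.1 + y, w.2) := by
  obtain ⟨m, hm⟩ := exists_schwartz_eq_hat Φ
  have hgrow : Function.HasTemperateGrowth (fun z : SymbolSpace n N => m z.1) :=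
    m.hasTemperateGrowth.comp (ContinuousLinearMap.fst ℝ (Rn n) (Fin N → Rn n)).hasTemperateGrowth
  have hφ' : ∀ z, SchwartzMap.smulLeftCLM ℂ (fun z : SymbolSpace n N => m z.1) φ z =
      hat (fun y => Φ y) z.1 * φ z := fun z => by
    rw [SchwartzMap.smulLeftCLM_apply_apply hgrow, hm, smul_eq_mul]
  refine ⟨_, hφ', fun w => ?_⟩
  have hph := continuous_phase (n := n) (N := N)
  have : ∀ z, Complex.exp (-(Complex.I * (phase z w : ℝ))) *
        SchwartzMap.smulLeftCLM ℂ (fun z : SymbolSpace n N => m z.1) φ z =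
      ∫ y, Φ y * (Complex.exp (-(Complex.I * (phase z (w.1 + y, w.2) : ℝ))) * φ z) := by
    intro z
    rw [hφ', hat, mul_comm _ (φ z), ← mul_assoc, ← integral_const_mul]
    congr 1; ext y
    have : phase z (w.1 + y, w.2) = phase z w + inner ℝ y z.1 := by
      simp only [phase, inner_add_right, real_inner_comm z.1 y]
      ring
    rw [this]
    push_cast
    rw [mul_add, neg_add, Complex.exp_add]
    ring
  rw [symbolHat_eq]
  simp only [this]
  rw [integral_integral_swap]
  · simp only [symbolHat_eq, integral_const_mul]
  · have h2 : Integrable (fun p : SymbolSpace n N × Rn n => φ p.1 * Φ p.2)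
      (volume.prod volume) := φ.integrable.mul_prod Φ.integrable
    refine (h2.bdd_mul (c := 1) (f := fun p => Complex.exp
      (-(Complex.I * (phase p.1 (w.1 + p.2, w.2) : ℝ)))) ?_ ?_).congr ?_
    · refine Continuous.aestronglyMeasurable ?_
      have : Continuous fun p : SymbolSpace n N × Rn n => phase p.1 (w.1 + p.2, w.2) :=
        hph.comp (by fun_prop : Continuous fun p : SymbolSpace n N × Rn n =>
          (p.1, ((w.1 + p.2, w.2) : SymbolSpace n N)))
      fun_prop
    · exact Filter.Eventually.of_forall fun p => (norm_cexp_neg_I _).le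
    · refine Filter.Eventually.of_forall fun p => ?_
      simp only [Function.uncurry]
      ring

theorem hat_mul_translate (Φ G : 𝓢(Rn n, ℂ)) (x ζ : Rn n) :
    ∫ y, Φ y * (G (x + y) * Complex.exp (Complex.I * (inner ℝ (x + y) ζ : ℝ))) =
      hat (fun z => Φ (z - x) * G z) (-ζ) := by
  rw [hat, ← integral_add_right_eq_self (fun z => Complex.exp
    (-(Complex.I * (inner ℝ z (-ζ) : ℝ))) * (Φ (z - x) * G z)) x]
  congr 1; ext y
  rw [add_sub_cancel_right, add_comm y x, inner_neg_right]
  push_cast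
  rw [mul_neg, neg_neg]
  ring

/-- The test functions built from `f` and from `F`, the latter multiplied by `Φ̂(w₀)`, agree near
the support of `𝓕σ`, so they pair equally with `𝓕σ`. The second pairing involves only the localized
data. -/
theorem enorm_integral_mul_multPsiDO_le {σ : SymbolSpace n N → ℂ} (hσ : Continuous σ)
    (hb : ∃ K : ℝ, ∀ z, ‖σ z‖ ≤ K) {R₀ : ℝ} {R : Fin N → ℝ}
    (hsupp : Distribution.dsupport (fourierDistribution σ) ⊆ productBall R₀ R)
    (Φ : 𝓢(Rn n, ℂ)) (hΦ : ∀ u, ‖u‖ < R₀ + 1 → hat (fun y => Φ y) u = 1)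
    (G : 𝓢(Rn n, ℂ)) (a : Rn n) (ρ : ℝ) (hG : ∀ x, G x ≠ 0 → ‖x - a‖ ≤ ρ)
    (f F : Fin N → 𝓢(Rn n, ℂ)) (hfF : ∀ j y, ‖y - a‖ < ρ + R j + 1 → f j y = F j y) :
    ‖∫ x, G x * multPsiDO σ f x‖ₑ ≤
      ∫⁻ w : SymbolSpace n N, ‖σ w‖ₑ *
        (‖hat (fun z => Φ (z - w.1) * G z) (-(∑ j, w.2 j))‖ₑ *
          ∏ j, ‖hat (fun y => F j y) (w.2 j)‖ₑ) := by
  obtain ⟨c, hc, h⟩ := exists_modulated_tensor_inverse n N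
  obtain ⟨φ, hφ1, hφ2⟩ := h G f
  obtain ⟨ψ, hψ1, hψ2⟩ := h G F
  obtain ⟨ψ', hψ'1, hψ'2⟩ := exists_schwartz_hat_mul Φ ψ
  -- The margin `1` in each radius makes this an open neighbourhood of the product ball, so the
  -- closed support of the difference misses the ball as well.
  have hvan : ∀ z : SymbolSpace n N, ‖z.1‖ < R₀ + 1 → (∀ j, ‖z.2 j‖ < R j + 1) →
      (φ - ψ') z = 0 := by
    intro z hz1 hz2
    rw [sub_apply, hψ'1, hΦ _ hz1, one_mul, hφ2, hψ2, sub_eq_zero]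
    congr 2
    ext x
    by_cases hx : G x = 0
    · simp [hx]
    · congr 1
      refine Finset.prod_congr rfl fun j _ => hfF j _ ?_
      calc ‖x + z.2 j - a‖ = ‖(x - a) + z.2 j‖ := by congr 1; abel
        _ ≤ ‖x - a‖ + ‖z.2 j‖ := norm_add_le _ _
        _ < _ := by linarith [hG x hx, hz2 j]
  have hO : IsOpen {z : SymbolSpace n N | ‖z.1‖ < R₀ + 1 ∧ ∀ j, ‖z.2 j‖ < R j + 1} := by
    simp only [Set.ofPred_and, Set.ofPred_forall]
    refine (isOpen_lt (by fun_prop) (by fun_prop)).inter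
      (isOpen_iInter_of_finite fun j => isOpen_lt (by fun_prop) (by fun_prop))
  have hts : tsupport (φ - ψ') ⊆
      {z : SymbolSpace n N | ‖z.1‖ < R₀ + 1 ∧ ∀ j, ‖z.2 j‖ < R j + 1}ᶜ := by
    refine closure_minimal (fun z hz => ?_) hO.isClosed_compl
    exact fun hz' => hz (hvan z hz'.1 hz'.2)
  have hzero := fourierDistribution_eq_zero hσ hb (φ - ψ') (by
    rw [Set.disjoint_left]
    intro z hz hz'
    refine hts hz ?_
    have := hsupp hz'
    simp only [productBall, Set.mem_prod, Metric.mem_closedBall, dist_zero_right, Set.mem_pi,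
      Set.mem_univ, true_implies] at this
    exact ⟨by linarith [this.1], fun j => by linarith [this.2 j]⟩)
  have hkey : ∫ w, σ w * symbolHat (fun z => φ z) w = ∫ w, σ w * symbolHat (fun z => ψ' z) w := by
    rw [← sub_eq_zero, ← integral_sub (integrable_mul_symbolHat hσ hb φ)
      (integrable_mul_symbolHat hσ hb ψ'), ← hzero, fourierDistribution]
    congr 1; ext w
    rw [← mul_sub, symbolHat_eq, symbolHat_eq, symbolHat_eq,
      ← integral_sub (integrable_symbolHat_integrand φ w) (integrable_symbolHat_integrand ψ' w)]
    congr 2; ext z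
    rw [← mul_sub]; rfl
  have hleft : ∫ x, G x * multPsiDO σ f x = ((1 / (2 * Real.pi) ^ (N * n) : ℝ) : ℂ) *
      ∫ w, σ w * symbolHat (fun z => φ z) w := by
    have hi := integrable_mul_symbolHat hσ hb φ
    rw [Measure.volume_eq_prod] at hi
    rw [Measure.volume_eq_prod, integral_prod _ hi, ← integral_const_mul]
    congr 1; ext x
    rw [multPsiDO, ← mul_assoc, mul_comm (G x), mul_assoc, ← integral_const_mul]
    congr 2; ext ξ
    rw [hφ1]
    ring
  rw [hleft, hkey, enorm_mul]
  have hone : ‖((1 / (2 * Real.pi) ^ (N * n) : ℝ) : ℂ)‖ₑ ≤ 1 := by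
    rw [← ofReal_norm, ENNReal.ofReal_le_one, Complex.norm_real, Real.norm_of_nonneg (by positivity)]
    refine div_le_one_of_le₀ (one_le_pow₀ ?_) (by positivity)
    linarith [Real.pi_gt_three]
  refine (mul_le_of_le_one_left (zero_le) hone).trans ?_
  refine (enorm_integral_le_lintegral_enorm _).trans (lintegral_mono fun w => ?_)
  rw [enorm_mul]
  refine mul_le_mul' le_rfl (le_of_eq ?_)
  rw [hψ'2]
  simp only [hψ1, ← mul_assoc]
  rw [integral_mul_const, enorm_mul, ← hat_mul_translate]
  simp only [← mul_assoc]
  congr 1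
  simp only [← ofReal_norm, norm_prod]
  rw [ENNReal.ofReal_prod_of_nonneg (fun _ _ => norm_nonneg _)]

end Localization

end

/-! ### Tiling by lattice translates of the unit cube -/

noncomputable section

section Tiling

theorem lintegral_eq_tsum_translates {S ι : Type*} [AddGroup S] [MeasurableSpace S]
    [MeasurableAdd S] [Countable ι] (μ : Measure S) [μ.IsAddRightInvariant] (l : ι → S)
    {D : Set S} (hD : MeasurableSet D) (κ : S → ι) (hκ : ∀ x i, x - l i ∈ D ↔ κ x = i)
    (f : S → ℝ≥0∞) : ∫⁻ x, f x ∂μ = ∑' i, ∫⁻ x in D, f (x + l i) ∂μ := by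
  have hm : ∀ i, MeasurableSet {x | κ x = i} := by
    intro i
    have : {x | κ x = i} = (fun x => x + -l i) ⁻¹' D := by
      ext x
      simp [← hκ, sub_eq_add_neg]
    rw [this]
    exact (measurable_add_const _) hD
  have hU : (⋃ i, {x | κ x = i}) = Set.univ := by
    ext x; simp
  rw [← setLIntegral_univ, ← hU, lintegral_iUnion hm]
  · refine tsum_congr fun i => ?_
    have hp : (fun x => x + l i) ⁻¹' {x | κ x = i} = D := by
      ext x
      simp only [Set.mem_preimage, Set.mem_ofPred_eq, ← hκ, add_sub_cancel_right]
    rw [← (measurePreserving_add_right μ (l i)).setLIntegral_comp_preimage_emb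
      (measurableEmbedding_addRight (l i)), hp]
  · intro i j hij
    rw [Function.onFun, Set.disjoint_left]
    rintro x rfl h2
    exact hij h2

variable {n N : ℕ}

theorem measurableSet_unitCube (n : ℕ) : MeasurableSet (unitCube n) := by
  have : unitCube n = ⋂ i, (fun x : Rn n => x i) ⁻¹' Set.Ico (-(1 / 2) : ℝ) (1 / 2) := by
    ext x; simp [unitCube]
  rw [this]
  exact MeasurableSet.iInter fun i => (by fun_prop : Measurable fun x : Rn n => x i)
    measurableSet_Ico

/-- The index of the lattice cube containing a point. -/
def cubeIndex (x : Rn n) : Zn n := fun i => ⌊x i + 1 / 2⌋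

theorem sub_latticePoint_mem_unitCube (x : Rn n) (ν : Zn n) :
    x - latticePoint ν ∈ unitCube n ↔ cubeIndex x = ν := by
  simp only [unitCube, cubeIndex, funext_iff, Int.floor_eq_iff, Set.mem_ofPred_eq, Set.mem_Ico]
  refine forall_congr' fun i => ?_
  have : (x - latticePoint ν) i = x i - ν i := rfl
  rw [this]
  constructor <;> rintro ⟨h1, h2⟩ <;> constructor <;> linarith

theorem lintegral_eq_tsum_unitCube (f : Rn n → ℝ≥0∞) :
    ∫⁻ x, f x = ∑' ν : Zn n, ∫⁻ x in unitCube n, f (x + latticePoint ν) :=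
  lintegral_eq_tsum_translates volume latticePoint (measurableSet_unitCube n) cubeIndex
    sub_latticePoint_mem_unitCube f

/-- The unit cube of `(ℝⁿ)^(N+1)`. -/
def symbolCube (n N : ℕ) : Set (SymbolSpace n N) :=
  unitCube n ×ˢ Set.pi Set.univ fun _ : Fin N => unitCube n

theorem measurableSet_symbolCube (n N : ℕ) : MeasurableSet (symbolCube n N) :=
  (measurableSet_unitCube n).prod
    (MeasurableSet.univ_pi fun _ => measurableSet_unitCube n)

theorem lintegral_eq_tsum_symbolCube (f : SymbolSpace n N → ℝ≥0∞) :
    ∫⁻ z, f z = ∑' (ν₀ : Zn n) (ν : Fin N → Zn n), ∫⁻ z in symbolCube n N,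
      f (z.1 + latticePoint ν₀, fun j => z.2 j + latticePoint (ν j)) := by
  rw [lintegral_eq_tsum_translates volume
    (fun p : Zn n × (Fin N → Zn n) => ((latticePoint p.1, fun j => latticePoint (p.2 j)) :
      SymbolSpace n N)) (measurableSet_symbolCube n N)
    (fun z => (cubeIndex z.1, fun j => cubeIndex (z.2 j))) ?_ f]
  · rw [ENNReal.tsum_prod']
    rfl
  · intro z p
    simp only [symbolCube, Set.mem_prod, Set.mem_pi, Set.mem_univ, true_implies, Prod.fst_sub,
      Prod.snd_sub, Pi.sub_apply, sub_latticePoint_mem_unitCube, Prod.ext_iff, funext_iff]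

theorem norm_le_of_mem_unitCube {x : Rn n} (hx : x ∈ unitCube n) : ‖x‖ ≤ n := by
  rw [EuclideanSpace.norm_eq]
  refine Real.sqrt_le_iff.2 ⟨by positivity, ?_⟩
  have : ∀ i, ‖x i‖ ^ 2 ≤ 1 := by
    intro i
    have := hx i
    rw [Real.norm_eq_abs, sq_abs]
    nlinarith [this.1, this.2]
  calc ∑ i, ‖x i‖ ^ 2 ≤ ∑ _i : Fin n, (1 : ℝ) := Finset.sum_le_sum fun i _ => this i
    _ = n := by simp
    _ ≤ (n : ℝ) ^ 2 := by
      rcases Nat.eq_zero_or_pos n with h | h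
      · simp [h]
      · have : (1 : ℝ) ≤ n := by exact_mod_cast h
        nlinarith

theorem volume_unitCube_ne_zero (n : ℕ) : volume (unitCube n) ≠ 0 := by
  intro h
  have := lintegral_eq_tsum_unitCube (n := n) (fun _ => 1)
  simp only [Measure.restrict_eq_zero.2 h, lintegral_const, one_mul, Measure.coe_zero,
    Pi.zero_apply, tsum_zero] at this
  exact NeZero.ne (volume : Measure (Rn n)) (Measure.measure_univ_eq_zero.1 this)

theorem volume_unitCube_ne_top (n : ℕ) : volume (unitCube n) ≠ ∞ := by
  refine ne_top_of_le_ne_top (measure_closedBall_lt_top (x := (0 : Rn n)) (r := n)).ne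
    (measure_mono fun x hx => ?_)
  simpa using norm_le_of_mem_unitCube hx

end Tiling

/-! ### Integrable weights, sampled Fourier transforms and the reproducing kernel -/

section Weight

variable {n : ℕ}

/-- The integrable weight `(1 + |x|)^{-(n+1)}`. -/
def weight (x : Rn n) : ℝ≥0∞ := ENNReal.ofReal ((1 + ‖x‖) ^ (n + 1))⁻¹

theorem measurable_weight : Measurable (weight (n := n)) := by
  unfold weight
  fun_prop

theorem weight_ne_top (x : Rn n) : weight x ≠ ∞ := ENNReal.ofReal_ne_top

theorem one_add_norm_add_le (x y : Rn n) : 1 + ‖x + y‖ ≤ (1 + ‖x‖) * (1 + ‖y‖) := by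
  nlinarith [norm_add_le x y, norm_nonneg x, norm_nonneg y]

theorem weight_le {x y : Rn n} {T : ℝ} (hT : ‖x - y‖ ≤ T) :
    weight x ≤ ENNReal.ofReal ((1 + T) ^ (n + 1)) * weight y := by
  have hT0 : 0 ≤ T := (norm_nonneg _).trans hT
  unfold weight
  rw [← ENNReal.ofReal_mul (by positivity)]
  refine ENNReal.ofReal_le_ofReal ?_
  rw [← div_eq_mul_inv, inv_le_comm₀ (by positivity) (by positivity), inv_div,
    div_le_iff₀ (by positivity), ← mul_pow]
  refine pow_le_pow_left₀ (by positivity) ?_ _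
  calc 1 + ‖y‖ = 1 + ‖x + (y - x)‖ := by simp
    _ ≤ (1 + ‖x‖) * (1 + ‖y - x‖) := one_add_norm_add_le _ _
    _ ≤ _ := by rw [norm_sub_rev]; gcongr

theorem lintegral_weight_ne_top (n : ℕ) : ∫⁻ x : Rn n, weight x ≠ ∞ := by
  have h := finite_integral_one_add_norm (μ := (volume : Measure (Rn n))) (r := n + 1) (by simp)
  refine ne_of_lt (lt_of_le_of_lt (lintegral_mono fun x => ?_) h)
  unfold weight
  rw [Real.rpow_neg (by positivity)]
  norm_cast

/-- The weight varies by a bounded factor on unit cubes, so each term is at most a multiple of a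
cube average. The averages add up to the full integral, whose translation invariance makes the bound
uniform in `η`. -/
theorem exists_tsum_weight_le (n : ℕ) :
    ∃ C : ℝ≥0∞, C ≠ ∞ ∧ ∀ η : Rn n, ∑' κ : Zn n, weight (latticePoint κ + η) ≤ C := by
  refine ⟨(volume (unitCube n))⁻¹ * (ENNReal.ofReal ((1 + n) ^ (n + 1)) * ∫⁻ x : Rn n, weight x),
    ?_, fun η => ?_⟩
  · exact ENNReal.mul_ne_top (ENNReal.inv_ne_top.2 (volume_unitCube_ne_zero n))
      (ENNReal.mul_ne_top ENNReal.ofReal_ne_top (lintegral_weight_ne_top n))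
  have h1 : ∀ κ : Zn n, weight (latticePoint κ + η) ≤ (volume (unitCube n))⁻¹ *
      (ENNReal.ofReal ((1 + n) ^ (n + 1)) *
        ∫⁻ x in unitCube n, weight (x + latticePoint κ + η)) := by
    intro κ
    rw [mul_comm (volume (unitCube n))⁻¹, ← div_eq_mul_inv, ENNReal.le_div_iff_mul_le
      (Or.inl (volume_unitCube_ne_zero n)) (Or.inl (volume_unitCube_ne_top n)),
      ← setLIntegral_const, ← lintegral_const_mul' _ _ ENNReal.ofReal_ne_top]
    refine setLIntegral_mono' (measurableSet_unitCube n) fun x hx => weight_le ?_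
    have : latticePoint κ + η - (x + latticePoint κ + η) = -x := by abel
    rw [this, norm_neg]
    exact norm_le_of_mem_unitCube hx
  calc _ ≤ ∑' κ : Zn n, (volume (unitCube n))⁻¹ * (ENNReal.ofReal ((1 + n) ^ (n + 1)) *
        ∫⁻ x in unitCube n, weight (x + latticePoint κ + η)) := ENNReal.tsum_le_tsum h1
    _ = (volume (unitCube n))⁻¹ * (ENNReal.ofReal ((1 + n) ^ (n + 1)) *
        ∫⁻ x : Rn n, weight (x + η)) := by
      rw [ENNReal.tsum_mul_left, ENNReal.tsum_mul_left,
        lintegral_eq_tsum_unitCube (fun x => weight (x + η))]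
    _ = _ := by rw [lintegral_add_right_eq_self (fun x => weight x) η]

theorem exists_enorm_le_weight_pow (ψ : 𝓢(Rn n, ℂ)) (m : ℕ) :
    ∃ K : ℝ, 0 < K ∧ ∀ x, ‖ψ x‖ ≤ K * ((1 + ‖x‖) ^ m)⁻¹ := by
  refine ⟨2 ^ m * ((Finset.Iic (m, 0)).sup fun p => SchwartzMap.seminorm ℝ p.1 p.2) ψ + 1,
    by positivity, fun x => ?_⟩
  have := SchwartzMap.one_add_le_sup_seminorm_apply (𝕜 := ℝ) (m := (m, 0)) (k := m) (n := 0)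
    le_rfl le_rfl ψ x
  rw [norm_iteratedFDeriv_zero] at this
  rw [← div_eq_mul_inv, le_div_iff₀ (by positivity)]
  linarith

/-- The Cauchy–Schwarz inequality. -/
theorem lintegral_mul_le_sqrt_mul_sqrt {α : Type*} [MeasurableSpace α] (μ : Measure α)
    {f g : α → ℝ≥0∞} (hf : AEMeasurable f μ) (hg : AEMeasurable g μ) :
    ∫⁻ a, f a * g a ∂μ ≤ (∫⁻ a, f a ^ 2 ∂μ) ^ (1 / 2 : ℝ) * (∫⁻ a, g a ^ 2 ∂μ) ^ (1 / 2 : ℝ) := by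
  have := ENNReal.lintegral_mul_le_Lp_mul_Lq μ Real.HolderConjugate.two_two hf hg
  simpa using this

/-- Cauchy–Schwarz for the factors `f^{1/2}` and `f^{1/2} g`. -/
theorem sq_lintegral_mul_le {α : Type*} [MeasurableSpace α] (μ : Measure α)
    {f g : α → ℝ≥0∞} (hf : AEMeasurable f μ) (hg : AEMeasurable g μ) :
    (∫⁻ a, f a * g a ∂μ) ^ 2 ≤ (∫⁻ a, f a ∂μ) * ∫⁻ a, f a * g a ^ 2 ∂μ := by
  have hs : ∀ x : ℝ≥0∞, (x ^ (1 / 2 : ℝ)) ^ 2 = x := fun x => by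
    rw [← ENNReal.rpow_natCast, ← ENNReal.rpow_mul]; norm_num
  have h := lintegral_mul_le_sqrt_mul_sqrt μ (hf.pow_const (1 / 2 : ℝ))
    ((hf.pow_const (1 / 2 : ℝ)).mul hg)
  have h2 : ∀ a, f a ^ (1 / 2 : ℝ) * (f a ^ (1 / 2 : ℝ) * g a) = f a * g a := fun a => by
    rw [← mul_assoc, ← sq, hs]
  simp only [Pi.mul_apply, h2, mul_pow, hs] at h
  calc _ ≤ ((∫⁻ a, f a ∂μ) ^ (1 / 2 : ℝ) * (∫⁻ a, f a * g a ^ 2 ∂μ) ^ (1 / 2 : ℝ)) ^ 2 := by gcongr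
    _ = _ := by rw [mul_pow, hs, hs]

/-- A function supported in a fixed ball equals itself times a bump, so its transform is reproduced
by convolution with a modulated Schwartz function. Its supremum near `κ` is thus controlled by a
weighted `L²` average around `κ`; summing the weights and applying Plancherel concludes. The centre
`a` enters only through a unimodular factor, whence the uniformity. -/
theorem exists_tsum_sup_hat_sq_le (n : ℕ) (ρ T : ℝ) :
    ∃ C : ℝ≥0∞, C ≠ ∞ ∧ ∀ (a : Rn n) (h : 𝓢(Rn n, ℂ)), (∀ z, h z ≠ 0 → ‖z - a‖ ≤ ρ) →
      ∑' κ : Zn n, (⨆ t : Metric.closedBall (0 : Rn n) T,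
        ‖hat (fun z => h z) (-(latticePoint κ + t))‖ₑ) ^ 2 ≤ C * ∫⁻ z, ‖h z‖ₑ ^ 2 := by
  let b : ContDiffBump (0 : Rn n) := ⟨|ρ| + 1, |ρ| + 2, by positivity, by linarith⟩
  have hbs : ContDiff ℝ (⊤ : ℕ∞) (fun z => ((b z : ℝ) : ℂ)) :=
    Complex.ofRealCLM.contDiff.comp b.contDiff
  have hbc : HasCompactSupport (fun z => ((b z : ℝ) : ℂ)) :=
    b.hasCompactSupport.comp_left (g := fun r : ℝ => (r : ℂ)) (by simp)
  obtain ⟨c, -, hc⟩ := exists_hat_inverse n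
  obtain ⟨ψ, hψ, -⟩ := hc (hbc.toSchwartzMap hbs)
  replace hψ : ∀ w, hat (fun z => ψ z) w = (b w : ℂ) := fun w => (hψ w).trans (by simp)
  obtain ⟨K, hK, hψK⟩ := exists_enorm_le_weight_pow ψ (n + 1)
  obtain ⟨CL, hCL, hsumL⟩ := exists_tsum_weight_le n
  obtain ⟨cp, hcp, hplan⟩ := exists_lintegral_hat_sq n
  set L : ℝ≥0∞ := ∫⁻ η, ‖ψ η‖ₑ
  have hL : L ≠ ∞ := ψ.integrable.2.ne
  set K' : ℝ≥0∞ := ENNReal.ofReal K * ENNReal.ofReal ((1 + T) ^ (n + 1))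
  have hK' : K' ≠ ∞ := ENNReal.mul_ne_top ENNReal.ofReal_ne_top ENNReal.ofReal_ne_top
  refine ⟨L * K' * CL * ENNReal.ofReal cp, by finiteness, fun a h hh => ?_⟩
  obtain ⟨g, hg⟩ := exists_schwartz_eq_hat h
  have hrep : ∀ ζ, ‖hat (fun z => h z) ζ‖ₑ ≤ ∫⁻ η, ‖ψ η‖ₑ * ‖g (η + ζ)‖ₑ := by
    intro ζ
    have h1 : ∀ z, Complex.exp (-(Complex.I * (inner ℝ z ζ : ℝ))) * h z =
        ∫ η, (Complex.exp (Complex.I * (inner ℝ η a : ℝ)) * ψ η) *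
          (Complex.exp (-(Complex.I * (inner ℝ z (η + ζ) : ℝ))) * h z) := by
      intro z
      have h2 : h z = hat (fun z => ψ z) (z - a) * h z := by
        by_cases hz : h z = 0
        · simp [hz]
        · have : b (z - a) = 1 := b.one_of_mem_closedBall (by
            simp only [mem_closedBall_zero_iff]
            have := hh z hz
            have h3 := le_abs_self ρ
            change ‖z - a‖ ≤ |ρ| + 1
            linarith)
          rw [hψ, this]; simp
      conv_lhs => rw [h2]
      rw [hat, mul_comm _ (h z), ← mul_assoc, ← integral_const_mul]
      congr 1; ext η
      rw [inner_add_right, inner_sub_right, real_inner_comm z η]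
      push_cast
      rw [mul_add, mul_sub, neg_add, neg_sub, sub_eq_add_neg, Complex.exp_add, Complex.exp_add]
      ring
    rw [hat]
    simp only [h1]
    rw [integral_integral_swap]
    · simp only [integral_const_mul]
      refine (enorm_integral_le_lintegral_enorm _).trans (lintegral_mono fun η => ?_)
      have h5 : ∫ z, Complex.exp (-(Complex.I * (inner ℝ z (η + ζ) : ℝ))) * h z = g (η + ζ) :=
        hg _
      rw [h5, enorm_mul, enorm_mul, ← ofReal_norm (Complex.exp _), norm_cexp_I]
      simp
    · have h2 : Integrable (fun p : Rn n × Rn n => h p.1 * ψ p.2)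
        (volume.prod volume) := h.integrable.mul_prod ψ.integrable
      refine (h2.bdd_mul (c := 1) (f := fun p => Complex.exp (Complex.I * (inner ℝ p.2 a : ℝ)) *
        Complex.exp (-(Complex.I * (inner ℝ p.1 (p.2 + ζ) : ℝ)))) ?_ ?_).congr ?_
      · refine Continuous.aestronglyMeasurable ?_
        fun_prop
      · refine Filter.Eventually.of_forall fun p => ?_
        rw [norm_mul, norm_cexp_I, norm_cexp_neg_I, one_mul]
      · refine Filter.Eventually.of_forall fun p => ?_
        simp only [Function.uncurry]
        ring
  have hterm : ∀ κ : Zn n, (⨆ t : Metric.closedBall (0 : Rn n) T,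
        ‖hat (fun z => h z) (-(latticePoint κ + t))‖ₑ) ^ 2 ≤
      L * (K' * ∫⁻ η, weight (latticePoint κ + η) * ‖g η‖ₑ ^ 2) := by
    intro κ
    rw [ENNReal.iSup_pow_of_ne_zero two_ne_zero]
    refine iSup_le fun t => ?_
    set ζ := -(latticePoint κ + (t : Rn n))
    calc ‖hat (fun z => h z) ζ‖ₑ ^ 2 ≤ (∫⁻ η, ‖ψ η‖ₑ * ‖g (η + ζ)‖ₑ) ^ 2 := by
          gcongr; exact hrep ζ
      _ ≤ L * ∫⁻ η, ‖ψ η‖ₑ * ‖g (η + ζ)‖ₑ ^ 2 := by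
          refine sq_lintegral_mul_le _ ψ.continuous.enorm.aemeasurable ?_
          exact (g.continuous.comp (by fun_prop : Continuous fun η => η + ζ)).enorm.aemeasurable
      _ = L * ∫⁻ η, ‖ψ (η - ζ)‖ₑ * ‖g η‖ₑ ^ 2 := by
          rw [← lintegral_sub_right_eq_self (fun η => ‖ψ η‖ₑ * ‖g (η + ζ)‖ₑ ^ 2) ζ]
          simp
      _ ≤ _ := by
          gcongr
          rw [← lintegral_const_mul' _ _ hK']
          refine lintegral_mono fun η => ?_
          rw [← mul_assoc]
          gcongr
          calc ‖ψ (η - ζ)‖ₑ ≤ ENNReal.ofReal K * weight (η - ζ) := by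
                rw [← ofReal_norm, weight, ← ENNReal.ofReal_mul hK.le]
                exact ENNReal.ofReal_le_ofReal (hψK _)
            _ ≤ _ := by
                rw [mul_assoc]
                gcongr
                refine weight_le ?_
                have : η - ζ - (latticePoint κ + η) = t := by simp only [ζ]; abel
                rw [this]
                exact mem_closedBall_zero_iff.1 t.2
  calc _ ≤ ∑' κ : Zn n, L * (K' * ∫⁻ η, weight (latticePoint κ + η) * ‖g η‖ₑ ^ 2) :=
        ENNReal.tsum_le_tsum hterm
    _ = L * K' * ∫⁻ η, (∑' κ : Zn n, weight (latticePoint κ + η)) * ‖g η‖ₑ ^ 2 := by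
        rw [ENNReal.tsum_mul_left, ENNReal.tsum_mul_left, ← mul_assoc]
        congr 1
        rw [← lintegral_tsum]
        · simp only [ENNReal.tsum_mul_right]
        · intro κ
          exact ((measurable_weight.comp (measurable_const_add _)).mul
            (g.continuous.enorm.measurable.pow_const 2)).aemeasurable
    _ ≤ L * K' * ∫⁻ η, CL * ‖g η‖ₑ ^ 2 := by
        gcongr with η
        exact hsumL η
    _ = _ := by
        rw [lintegral_const_mul' _ _ hCL]
        simp only [← hg]
        rw [hplan]
        ring

/-- The kernel is `Φ(y) = R₀^n ψ(R₀ y)` with `ψ̂` a fixed bump. Its squared `L²` norm scales like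
`R₀^n`, the source of the factor `R₀^{n/2}`, and since `R₀ ≥ 1` its decay is at least that of `ψ` up
to this scaling. -/
theorem exists_reproducing_kernel (n : ℕ) :
    ∃ C : ℝ≥0∞, C ≠ ∞ ∧ ∀ R₀ : ℝ, 1 ≤ R₀ → ∃ Φ : 𝓢(Rn n, ℂ),
      (∀ u, ‖u‖ < R₀ + 1 → hat (fun y => Φ y) u = 1) ∧
      ∀ (z : Rn n) (ν : Zn n), ∫⁻ x in unitCube n, ‖Φ (z - (x + latticePoint ν))‖ₑ ^ 2 ≤
        C * ENNReal.ofReal (R₀ ^ n) * weight (latticePoint ν - z) ^ 2 := by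
  -- Inner radius `2` suffices because `R₀ + 1 ≤ 2 R₀`.
  let b : ContDiffBump (0 : Rn n) := ⟨2, 3, by norm_num, by norm_num⟩
  have hbs : ContDiff ℝ (⊤ : ℕ∞) (fun z => ((b z : ℝ) : ℂ)) :=
    Complex.ofRealCLM.contDiff.comp b.contDiff
  have hbc : HasCompactSupport (fun z => ((b z : ℝ) : ℂ)) :=
    b.hasCompactSupport.comp_left (g := fun r : ℝ => (r : ℂ)) (by simp)
  obtain ⟨c, -, hc⟩ := exists_hat_inverse n
  obtain ⟨ψ, hψ, -⟩ := hc (hbc.toSchwartzMap hbs)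
  replace hψ : ∀ w, hat (fun z => ψ z) w = (b w : ℂ) := fun w => (hψ w).trans (by simp)
  -- This decay gives four powers of the weight in `|ψ|²`: two are kept as off-diagonal decay, one
  -- provides integrability after scaling, and one is bounded by `1`.
  obtain ⟨K, hK, hψK⟩ := exists_enorm_le_weight_pow ψ (2 * (n + 1))
  set I : ℝ≥0∞ := ∫⁻ x : Rn n, weight x
  set D : ℝ≥0∞ := ENNReal.ofReal ((1 + n) ^ (n + 1))
  have hI : I ≠ ∞ := lintegral_weight_ne_top n
  refine ⟨ENNReal.ofReal (K ^ 2) * D ^ 2 * I, by finiteness, fun R₀ hR₀ => ?_⟩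
  have hR0 : 0 < R₀ := by linarith
  let e : Rn n ≃L[ℝ] Rn n := ContinuousLinearEquiv.smulLeft (Units.mk0 R₀ hR0.ne')
  have he : ∀ y, e y = R₀ • y := fun y => rfl
  refine ⟨((R₀ ^ n : ℝ) : ℂ) • SchwartzMap.compCLMOfContinuousLinearEquiv ℝ e ψ, fun u hu => ?_,
    fun z ν => ?_⟩
  · have h1 : hat (fun y => (((R₀ ^ n : ℝ) : ℂ) •
        SchwartzMap.compCLMOfContinuousLinearEquiv ℝ e ψ) y) u =
        hat (fun y => ψ y) (R₀⁻¹ • u) := by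
      have h2 := Measure.integral_comp_smul (volume : Measure (Rn n))
        (fun y => Complex.exp (-(Complex.I * (inner ℝ y (R₀⁻¹ • u) : ℝ))) * ψ y) R₀
      rw [finrank_euclideanSpace_fin, abs_of_pos (by positivity), Complex.real_smul] at h2
      have h3 : ((R₀ ^ n : ℝ) : ℂ) * ((R₀ ^ n)⁻¹ : ℝ) = 1 := by
        rw [← Complex.ofReal_mul, mul_inv_cancel₀ (by positivity)]; simp
      rw [hat, hat, ← one_mul (∫ y, Complex.exp (-(Complex.I * (inner ℝ y (R₀⁻¹ • u) : ℝ))) * ψ y),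
        ← h3, mul_assoc, ← h2, ← integral_const_mul]
      congr 1; ext y
      rw [smul_apply, SchwartzMap.compCLMOfContinuousLinearEquiv_apply, Function.comp, he,
        inner_smul_left, inner_smul_right, smul_eq_mul]
      have : (starRingEnd ℝ) R₀ * (R₀⁻¹ * inner ℝ y u) = inner ℝ y u := by
        rw [RCLike.conj_to_real, ← mul_assoc, mul_inv_cancel₀ hR0.ne', one_mul]
      rw [this]
      ring
    rw [h1, hψ, b.one_of_mem_closedBall]
    · simp
    · rw [mem_closedBall_zero_iff, norm_smul, norm_inv, Real.norm_of_nonneg hR0.le]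
      change R₀⁻¹ * ‖u‖ ≤ 2
      rw [inv_mul_le_iff₀ hR0]
      linarith
  · have hpt : ∀ y : Rn n, ‖(((R₀ ^ n : ℝ) : ℂ) •
        SchwartzMap.compCLMOfContinuousLinearEquiv ℝ e ψ) y‖ₑ ^ 2 ≤
        ENNReal.ofReal (K ^ 2) * ENNReal.ofReal (R₀ ^ n) *
          (weight y ^ 2 * (ENNReal.ofReal (R₀ ^ n) * weight (R₀ • y))) := by
      intro y
      rw [smul_apply, SchwartzMap.compCLMOfContinuousLinearEquiv_apply, Function.comp, he,
        ← ofReal_norm, ← ENNReal.ofReal_pow (norm_nonneg _), weight, weight,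
        ← ENNReal.ofReal_pow (by positivity), ← ENNReal.ofReal_mul (by positivity),
        ← ENNReal.ofReal_mul (by positivity), ← ENNReal.ofReal_mul (by positivity),
        ← ENNReal.ofReal_mul (by positivity)]
      refine ENNReal.ofReal_le_ofReal ?_
      rw [norm_smul, Complex.norm_real, Real.norm_of_nonneg (by positivity)]
      have h4 : ‖ψ (R₀ • y)‖ ^ 2 ≤ (K * ((1 + ‖R₀ • y‖) ^ (2 * (n + 1)))⁻¹) ^ 2 := by
        gcongr; exact hψK _
      have h5 : (1 + ‖y‖) ≤ 1 + ‖R₀ • y‖ := by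
        rw [norm_smul, Real.norm_of_nonneg hR0.le]
        nlinarith [norm_nonneg y]
      set p := ((1 + ‖R₀ • y‖) ^ (n + 1))⁻¹
      set p' := ((1 + ‖y‖) ^ (n + 1))⁻¹
      have hp' : p ≤ p' := inv_anti₀ (by positivity) (by gcongr)
      have hp0 : 0 ≤ p := by positivity
      have hp1 : p ≤ 1 := inv_le_one_of_one_le₀ (one_le_pow₀ (by linarith [norm_nonneg (R₀ • y)]))
      have h6 : ((1 + ‖R₀ • y‖) ^ (2 * (n + 1)))⁻¹ = p ^ 2 := by
        rw [mul_comm, pow_mul, inv_pow]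
      rw [h6] at h4
      calc (R₀ ^ n * ‖ψ (R₀ • y)‖) ^ 2 = (R₀ ^ n) ^ 2 * ‖ψ (R₀ • y)‖ ^ 2 := by ring
        _ ≤ (R₀ ^ n) ^ 2 * (K * p ^ 2) ^ 2 := by gcongr
        _ = K ^ 2 * R₀ ^ n * (p ^ 2 * (R₀ ^ n * (p * p))) := by ring
        _ ≤ K ^ 2 * R₀ ^ n * (p' ^ 2 * (R₀ ^ n * (1 * p))) := by gcongr
        _ = _ := by ring
    have hscale : ∫⁻ y : Rn n, ENNReal.ofReal (R₀ ^ n) * weight (R₀ • y) = I := by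
      have hi : Integrable (fun x : Rn n => ((1 + ‖x‖) ^ (n + 1))⁻¹) := by
        refine ⟨by fun_prop, ?_⟩
        refine lt_of_le_of_lt (lintegral_mono fun x => ?_) hI.lt_top
        rw [weight, ← ofReal_norm, Real.norm_of_nonneg (by positivity)]
      have h2 := Measure.integral_comp_smul (volume : Measure (Rn n))
        (fun x : Rn n => ((1 + ‖x‖) ^ (n + 1))⁻¹) R₀
      rw [finrank_euclideanSpace_fin, abs_of_pos (by positivity), smul_eq_mul] at h2
      have hi2 : Integrable (fun x : Rn n => ((1 + ‖R₀ • x‖) ^ (n + 1))⁻¹) :=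
        hi.comp_smul hR0.ne'
      rw [lintegral_const_mul' _ _ ENNReal.ofReal_ne_top]
      simp only [I, weight]
      rw [← ofReal_integral_eq_lintegral_ofReal hi (Filter.Eventually.of_forall fun x => by positivity),
        ← ofReal_integral_eq_lintegral_ofReal hi2
          (Filter.Eventually.of_forall fun x => by positivity), h2,
        ← ENNReal.ofReal_mul (by positivity), ← mul_assoc, mul_inv_cancel₀ (by positivity), one_mul]
    calc _ ≤ ∫⁻ x in unitCube n, ENNReal.ofReal (K ^ 2) * ENNReal.ofReal (R₀ ^ n) *
          ((D * weight (latticePoint ν - z)) ^ 2 * (ENNReal.ofReal (R₀ ^ n) *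
            weight (R₀ • (z - (x + latticePoint ν))))) := by
          refine setLIntegral_mono' (measurableSet_unitCube n) fun x hx => (hpt _).trans ?_
          gcongr
          have hsymm : weight (z - (x + latticePoint ν)) = weight (x + latticePoint ν - z) := by
            rw [weight, weight, norm_sub_rev]
          rw [hsymm]
          refine weight_le ?_
          have : x + latticePoint ν - z - (latticePoint ν - z) = x := by abel
          rw [this]
          exact norm_le_of_mem_unitCube hx
      _ ≤ ENNReal.ofReal (K ^ 2) * ENNReal.ofReal (R₀ ^ n) *
          ((D * weight (latticePoint ν - z)) ^ 2 *
            ∫⁻ x, ENNReal.ofReal (R₀ ^ n) * weight (R₀ • (z - (x + latticePoint ν)))) := by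
          rw [lintegral_const_mul' _ _ (by finiteness), lintegral_const_mul' _ _ (by
            have := weight_ne_top (latticePoint ν - z)
            finiteness)]
          gcongr
          exact Measure.restrict_le_self
      _ = _ := by
          have h7 : ∫⁻ x, ENNReal.ofReal (R₀ ^ n) * weight (R₀ • (z - (x + latticePoint ν))) = I := by
            rw [← hscale, ← lintegral_sub_left_eq_self
              (fun y => ENNReal.ofReal (R₀ ^ n) * weight (R₀ • y)) (z - latticePoint ν)]
            congr 1; ext x; congr 3; abel
          rw [h7]
          ring

end Weight

end

/-! ### The local estimate: Cauchy–Schwarz on cubes and the class `𝓑_N` -/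

noncomputable section

section LocalEstimate

variable {n N : ℕ}

theorem lintegral_fin_prod_eq_prod {E : Type*} [MeasurableSpace E] {N : ℕ} (μ : Measure E)
    [SigmaFinite μ] {f : Fin N → E → ℝ≥0∞} (hf : ∀ i, Measurable (f i)) :
    ∫⁻ x, ∏ i, f i (x i) ∂(Measure.pi fun _ : Fin N => μ) = ∏ i, ∫⁻ y, f i y ∂μ := by
  induction N with
  | zero => simp
  | succ N ih =>
    have h := (measurePreserving_piFinSuccAbove (fun _ : Fin (N + 1) => μ) 0).symm
    rw [← h.lintegral_comp_emb (MeasurableEquiv.measurableEmbedding _)]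
    simp_rw [MeasurableEquiv.piFinSuccAbove_symm_apply, Fin.insertNthEquiv,
      Fin.prod_univ_succ, Fin.insertNth_zero]
    simp only [Equiv.coe_fn_mk, Fin.cons_zero, Fin.cons_succ, cast_eq]
    rw [lintegral_prod_mul (hf 0).aemeasurable (g := fun y : Fin N → E => ∏ i, f i.succ (y i)), ih]
    · exact fun i => hf _
    · exact (Finset.measurable_prod _ fun i _ => (hf _).comp (measurable_pi_apply i)).aemeasurable

theorem lintegral_symbolCube_mul_prod {g : Rn n → ℝ≥0∞} (hg : Measurable g)
    {f : Fin N → Rn n → ℝ≥0∞} (hf : ∀ i, Measurable (f i)) :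
    ∫⁻ z in symbolCube n N, g z.1 * ∏ j, f j (z.2 j) =
      (∫⁻ x in unitCube n, g x) * ∏ j, ∫⁻ ξ in unitCube n, f j ξ := by
  have h1 : (volume : Measure (SymbolSpace n N)).restrict (symbolCube n N) =
      (volume.restrict (unitCube n)).prod (Measure.pi fun _ : Fin N => volume.restrict (unitCube n)) := by
    rw [Measure.volume_eq_prod, symbolCube, ← Measure.prod_restrict, volume_pi,
      Measure.restrict_pi_pi]
  rw [h1, lintegral_prod_mul hg.aemeasurable (g := fun ξ : Fin N → Rn n => ∏ j, f j (ξ j)),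
    lintegral_fin_prod_eq_prod _ hf]
  exact (Finset.measurable_prod _ fun i _ => (hf _).comp (measurable_pi_apply i)).aemeasurable

theorem continuous_hat_mul_translate (Φ G : 𝓢(Rn n, ℂ)) :
    Continuous fun p : Rn n × Rn n => hat (fun z => Φ (z - p.1) * G z) p.2 := by
  obtain ⟨K, hK⟩ : ∃ K, ∀ z, ‖Φ z‖ ≤ K := ⟨_, fun z => Φ.norm_le_seminorm ℝ z⟩
  have hΦ := Φ.continuous
  have hG := G.continuous
  refine continuous_of_dominated (bound := fun z => K * ‖G z‖) (fun p => ?_)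
    (fun p => Filter.Eventually.of_forall fun z => ?_) (G.integrable.norm.const_mul K)
    (Filter.Eventually.of_forall fun z => ?_)
  · exact Continuous.aestronglyMeasurable (by fun_prop)
  · rw [norm_mul, norm_cexp_neg_I, one_mul, norm_mul]
    gcongr
    exact hK _
  · fun_prop

theorem exists_schwartz_eq_mul_translate (Φ G : 𝓢(Rn n, ℂ)) (x : Rn n) :
    ∃ h : 𝓢(Rn n, ℂ), ∀ z, h z = Φ (z - x) * G z := by
  refine ⟨SchwartzMap.smulLeftCLM ℂ (fun z => SchwartzMap.compSubConstCLM ℝ x Φ z) G, fun z => ?_⟩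
  rw [SchwartzMap.smulLeftCLM_apply_apply (SchwartzMap.hasTemperateGrowth _),
    SchwartzMap.compSubConstCLM_apply, smul_eq_mul]

theorem IsModerate.exists_le_mul {W : (Fin N → Rn n) → ℝ} (hW : IsModerate W) :
    ∃ C : ℝ, 0 < C ∧ ∀ (μ ξ : Fin N → Rn n), (∀ j, ξ j ∈ unitCube n) →
      W (fun j => ξ j + μ j) ≤ C * W μ := by
  obtain ⟨-, hpos, C, M, hC, hM, h⟩ := hW
  refine ⟨C * Real.sqrt (1 + ∑ _j : Fin N, (n : ℝ) ^ 2) ^ M, by positivity, fun μ ξ hξ => ?_⟩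
  have h1 := h μ ξ
  have h2 : (fun j => ξ j + μ j) = μ + ξ := by ext1 j; exact add_comm _ _
  rw [h2]
  refine h1.trans ?_
  have := (hpos μ).le
  calc C * W μ * Real.sqrt (1 + ∑ j, ‖ξ j‖ ^ 2) ^ M
      ≤ C * W μ * Real.sqrt (1 + ∑ _j : Fin N, (n : ℝ) ^ 2) ^ M := by
        gcongr with j
        exact norm_le_of_mem_unitCube (hξ j)
    _ = _ := by ring

theorem eLpNorm_two_eq {α E : Type*} [MeasurableSpace α] [NormedAddCommGroup E] (μ : Measure α)
    (f : α → E) : eLpNorm f 2 μ = (∫⁻ x, ‖f x‖ₑ ^ 2 ∂μ) ^ (1 / 2 : ℝ) := by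
  rw [eLpNorm_eq_lintegral_rpow_enorm_toReal (by norm_num) (by norm_num)]
  simp

theorem lqNorm_two_eq {ι : Type*} (a : ι → ℝ≥0∞) : lqNorm 2 a = (∑' k, a k ^ 2) ^ (1 / 2 : ℝ) := by
  simp [lqNorm]

theorem sq_rpow_half (x : ℝ≥0∞) : (x ^ (1 / 2 : ℝ)) ^ 2 = x := by
  rw [← ENNReal.rpow_natCast, ← ENNReal.rpow_mul]
  norm_num

theorem rpow_half_sq (x : ℝ≥0∞) : (x ^ 2) ^ (1 / 2 : ℝ) = x := by
  rw [← ENNReal.rpow_natCast, ← ENNReal.rpow_mul]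
  norm_num

/-- Passes to sequences with values in `[0, ∞]`: a finite `ℓ²` norm forces every entry to be finite.
-/
theorem ClassB.exists_tsum_le {V : (Fin N → Zn n) → ℝ} (hV : ClassB V) :
    ∃ c : ℝ≥0∞, c ≠ ∞ ∧ ∀ (A₀ : Zn n → ℝ≥0∞) (A : Fin N → Zn n → ℝ≥0∞),
      (∑' κ, A₀ κ ^ 2 ≠ ∞) → (∀ j, ∑' κ, A j κ ^ 2 ≠ ∞) →
      ∑' ν : Fin N → Zn n, ENNReal.ofReal (V ν) * A₀ (∑ j, ν j) * ∏ j, A j (ν j) ≤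
        c * ((∑' κ, A₀ κ ^ 2) ^ (1 / 2 : ℝ) * ∏ j, (∑' κ, A j κ ^ 2) ^ (1 / 2 : ℝ)) := by
  obtain ⟨-, c, -, h⟩ := hV
  refine ⟨ENNReal.ofReal c, ENNReal.ofReal_ne_top, fun A₀ A h₀ hA => ?_⟩
  have hfin : ∀ a : Zn n → ℝ≥0∞, ∑' κ, a κ ^ 2 ≠ ∞ → ∀ κ, a κ ≠ ∞ := by
    intro a ha κ hκ
    refine ENNReal.ne_top_of_tsum_ne_top ha κ ?_
    simp [hκ]
  have h1 := h (fun κ => (A₀ κ).toNNReal) (fun j κ => (A j κ).toNNReal)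
  simpa only [ENNReal.coe_toNNReal (hfin _ h₀ _), ENNReal.coe_toNNReal (hfin _ (hA _) _),
    lqNorm_two_eq] using h1

theorem sum_add_latticePoint (ξ : Fin N → Rn n) (μ : Fin N → Zn n) :
    ∑ j, (ξ j + latticePoint (μ j)) = latticePoint (∑ j, μ j) + ∑ j, ξ j := by
  rw [Finset.sum_add_distrib, add_comm]
  congr 1
  ext i
  simp [latticePoint]

/-- Write `σ = W · W⁻¹σ`; on a cube `W` is at most `C` times its value at the lattice point. -/
theorem lintegral_sq_symbolCube_le {W : (Fin N → Rn n) → ℝ} (hpos : ∀ ξ, 0 < W ξ) {C : ℝ}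
    (hC : 0 < C) (hW : ∀ (μ ξ : Fin N → Rn n), (∀ j, ξ j ∈ unitCube n) →
      W (fun j => ξ j + μ j) ≤ C * W μ) (σ : SymbolSpace n N → ℂ) (κ : Zn n) (μ : Fin N → Zn n) :
    (∫⁻ z in symbolCube n N, ‖σ (z.1 + latticePoint κ, fun j => z.2 j + latticePoint (μ j))‖ₑ ^ 2) ^
      (1 / 2 : ℝ) ≤ ENNReal.ofReal C * ENNReal.ofReal (W fun j => latticePoint (μ j)) *
        ulNorm (fun z : SymbolSpace n N => ((W z.2)⁻¹ : ℂ) * σ z) := by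
  have h1 : eLpNorm (fun z : SymbolSpace n N => ((W fun j => z.2 j + latticePoint (μ j))⁻¹ : ℂ) *
      σ (z.1 + latticePoint κ, fun j => z.2 j + latticePoint (μ j))) 2
      (volume.restrict (symbolCube n N)) ≤
      ulNorm (fun z : SymbolSpace n N => ((W z.2)⁻¹ : ℂ) * σ z) :=
    le_iSup₂_of_le κ μ le_rfl
  refine le_trans ?_ (mul_le_mul_right h1 _)
  rw [eLpNorm_two_eq, ← rpow_half_sq (ENNReal.ofReal C * _),
    ← ENNReal.mul_rpow_of_nonneg _ _ (by norm_num),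
    ← lintegral_const_mul' _ _ (by finiteness)]
  refine ENNReal.rpow_le_rpow (setLIntegral_mono' (measurableSet_symbolCube n N) fun z hz => ?_)
    (by norm_num)
  rw [← mul_pow]
  gcongr
  rw [enorm_mul, ← mul_assoc]
  set w := W fun j => z.2 j + latticePoint (μ j)
  have hw : 0 < w := hpos _
  have h2 : ENNReal.ofReal w * ‖((w : ℂ)⁻¹)‖ₑ = 1 := by
    rw [← ofReal_norm, norm_inv, Complex.norm_real, Real.norm_of_nonneg hw.le,
      ← ENNReal.ofReal_mul hw.le, mul_inv_cancel₀ hw.ne', ENNReal.ofReal_one]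
  calc _ = ENNReal.ofReal w * ‖((w : ℂ)⁻¹)‖ₑ *
        ‖σ (z.1 + latticePoint κ, fun j => z.2 j + latticePoint (μ j))‖ₑ := by rw [h2, one_mul]
    _ ≤ _ := by
      gcongr
      rw [← ENNReal.ofReal_mul hC.le]
      exact ENNReal.ofReal_le_ofReal (hW (fun j => latticePoint (μ j)) z.2
        (fun j => hz.2 j (Set.mem_univ j)))

/-- The factor `H` couples `x` with all the `ξ_j` through their sum, which stays within `N n` of the
lattice point `∑ μ_j`. Replacing `H` by its supremum `S` there decouples the variables, and after
Cauchy–Schwarz the integral factors. -/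
theorem lintegral_symbolCube_le {s : SymbolSpace n N → ℝ≥0∞} (hs : Continuous s)
    {H : Rn n → Rn n → ℝ≥0∞} (hH : Continuous fun p : Rn n × Rn n => H p.1 p.2)
    {S : Rn n → Zn n → ℝ≥0∞} (hSm : ∀ κ, Measurable fun x => S x κ)
    (hS : ∀ x κ t, ‖t‖ ≤ N * n → H x (-(latticePoint κ + t)) ≤ S x κ)
    {g : Fin N → Rn n → ℝ≥0∞} (hg : ∀ j, Continuous (g j)) (l : Zn n) (μ : Fin N → Zn n) :
    ∫⁻ z in symbolCube n N, s (z.1 + latticePoint l, fun j => z.2 j + latticePoint (μ j)) *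
        (H (z.1 + latticePoint l) (-(∑ j, (z.2 j + latticePoint (μ j)))) *
          ∏ j, g j (z.2 j + latticePoint (μ j))) ≤
      (∫⁻ z in symbolCube n N,
        s (z.1 + latticePoint l, fun j => z.2 j + latticePoint (μ j)) ^ 2) ^ (1 / 2 : ℝ) *
      ((∫⁻ x in unitCube n, S (x + latticePoint l) (∑ j, μ j) ^ 2) ^ (1 / 2 : ℝ) *
        ∏ j, (∫⁻ ξ in unitCube n, g j (ξ + latticePoint (μ j)) ^ 2) ^ (1 / 2 : ℝ)) := by
  have hhalf : (0 : ℝ) ≤ 1 / 2 := by norm_num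
  refine (lintegral_mul_le_sqrt_mul_sqrt _ ?_ ?_).trans ?_
  · exact (hs.comp (by fun_prop)).aemeasurable
  · refine AEMeasurable.mul ?_ ?_
    · refine Continuous.aemeasurable ?_
      exact hH.comp (by fun_prop : Continuous fun z : SymbolSpace n N =>
        (z.1 + latticePoint l, -(∑ j, (z.2 j + latticePoint (μ j)))))
    · exact Finset.aemeasurable_fun_prod _ fun j _ =>
        ((hg j).comp (by fun_prop : Continuous fun z : SymbolSpace n N =>
          z.2 j + latticePoint (μ j))).aemeasurable
  have h3 := lintegral_symbolCube_mul_prod (n := n) (N := N)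
    (g := fun x => S (x + latticePoint l) (∑ j, μ j) ^ 2)
    (((hSm _).comp (measurable_add_const _)).pow_const 2)
    (f := fun j ξ => g j (ξ + latticePoint (μ j)) ^ 2)
    (fun j => (((hg j).measurable.comp (measurable_add_const _)).pow_const 2))
  have h4 : (∫⁻ x in unitCube n, S (x + latticePoint l) (∑ j, μ j) ^ 2) ^ (1 / 2 : ℝ) *
      ∏ j, (∫⁻ ξ in unitCube n, g j (ξ + latticePoint (μ j)) ^ 2) ^ (1 / 2 : ℝ) =
      (∫⁻ z in symbolCube n N, S (z.1 + latticePoint l) (∑ j, μ j) ^ 2 *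
        ∏ j, g j (z.2 j + latticePoint (μ j)) ^ 2) ^ (1 / 2 : ℝ) := by
    rw [h3, ENNReal.mul_rpow_of_nonneg _ _ hhalf, ENNReal.prod_rpow_of_nonneg hhalf]
  rw [h4]
  refine mul_le_mul_right (ENNReal.rpow_le_rpow (setLIntegral_mono'
    (measurableSet_symbolCube n N) fun z hz => ?_) hhalf) _
  rw [mul_pow, ← Finset.prod_pow]
  gcongr
  rw [sum_add_latticePoint]
  refine hS _ _ _ ((norm_sum_le _ _).trans ?_)
  calc ∑ j, ‖z.2 j‖ ≤ ∑ _j : Fin N, (n : ℝ) :=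
        Finset.sum_le_sum fun j _ => norm_le_of_mem_unitCube (hz.2 j (Set.mem_univ j))
    _ = _ := by simp

/-- The analytic core. For each fixed `x`-cube, the class `𝓑_N` inequality sums over all frequency
cubes; the kernel's decay away from `a` then sums over the `x`-cubes. Only `Φ` depends on `R₀`; `C`
does not. -/
theorem exists_lintegral_mul_hat_le (n N : ℕ) {W : (Fin N → Rn n) → ℝ} (hW : IsModerate W)
    (hWB : ClassB (fun ν : Fin N → Zn n => W (fun j => latticePoint (ν j)))) (ρ : ℝ) :
    ∃ C : ℝ≥0∞, C ≠ ∞ ∧ ∀ R₀ : ℝ, 1 ≤ R₀ → ∃ Φ : 𝓢(Rn n, ℂ),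
      (∀ u, ‖u‖ < R₀ + 1 → hat (fun y => Φ y) u = 1) ∧
      ∀ (σ : SymbolSpace n N → ℂ), Continuous σ → ∀ (a : Rn n) (G : 𝓢(Rn n, ℂ)),
        (∀ x, G x ≠ 0 → ‖x - a‖ ≤ ρ) → ∀ F : Fin N → 𝓢(Rn n, ℂ),
        ∫⁻ w : SymbolSpace n N, ‖σ w‖ₑ *
          (‖hat (fun z => Φ (z - w.1) * G z) (-(∑ j, w.2 j))‖ₑ *
            ∏ j, ‖hat (fun y => F j y) (w.2 j)‖ₑ) ≤
        C * ENNReal.ofReal (R₀ ^ ((n : ℝ) / 2)) *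
          ulNorm (fun z : SymbolSpace n N => ((W z.2)⁻¹ : ℂ) * σ z) *
          (∏ j, eLpNorm (F j) 2) * eLpNorm G 2 := by
  obtain ⟨cW, hcW, hcW'⟩ := hW.exists_le_mul
  obtain ⟨cB, hcB, hB⟩ := hWB.exists_tsum_le
  obtain ⟨cK, hcK, hK⟩ := exists_reproducing_kernel n
  obtain ⟨cS, hcS, hS⟩ := exists_tsum_sup_hat_sq_le n ρ (N * n)
  obtain ⟨cP, hcP, hP⟩ := exists_lintegral_hat_sq n
  obtain ⟨cL, hcL, hL⟩ := exists_tsum_weight_le n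
  set D : ℝ≥0∞ := ENNReal.ofReal ((1 + ρ) ^ (n + 1))
  have hhalf : (0 : ℝ) ≤ 1 / 2 := by norm_num
  refine ⟨ENNReal.ofReal cW * cB * ((cS * cK * D ^ 2) ^ (1 / 2 : ℝ) * cL) *
    (ENNReal.ofReal cP ^ (1 / 2 : ℝ)) ^ N, by finiteness, fun R₀ hR₀ => ?_⟩
  obtain ⟨Φ, hΦ1, hΦ2⟩ := hK R₀ hR₀
  refine ⟨Φ, hΦ1, fun σ hσ a G hG F => ?_⟩
  set U := ulNorm (fun z : SymbolSpace n N => ((W z.2)⁻¹ : ℂ) * σ z)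
  choose g hg using fun j => exists_schwartz_eq_hat (F j)
  have hcont := continuous_hat_mul_translate Φ G
  set H : Rn n → Rn n → ℝ≥0∞ := fun x ζ => ‖hat (fun z => Φ (z - x) * G z) ζ‖ₑ with hH
  have hHcont : Continuous fun p : Rn n × Rn n => H p.1 p.2 := hcont.enorm
  set S : Rn n → Zn n → ℝ≥0∞ := fun x κ =>
    ⨆ t : Metric.closedBall (0 : Rn n) (N * n), H x (-(latticePoint κ + t)) with hSdef
  -- The supremum is over an uncountable family; a supremum of continuous functions is lower
  -- semicontinuous, hence measurable.
  have hSm : ∀ κ, Measurable fun x => S x κ := by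
    intro κ
    refine LowerSemicontinuous.measurable (lowerSemicontinuous_iSup fun t => ?_)
    exact (hHcont.comp (by fun_prop : Continuous fun x : Rn n =>
      (x, -(latticePoint κ + (t : Rn n))))).lowerSemicontinuous
  set A₀ : Zn n → Zn n → ℝ≥0∞ := fun l κ =>
    (∫⁻ x in unitCube n, S (x + latticePoint l) κ ^ 2) ^ (1 / 2 : ℝ) with hA₀
  set A : Fin N → Zn n → ℝ≥0∞ := fun j κ =>
    (∫⁻ ξ in unitCube n, ‖g j (ξ + latticePoint κ)‖ₑ ^ 2) ^ (1 / 2 : ℝ) with hA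
  have hcell : ∀ (l : Zn n) (μ : Fin N → Zn n),
      ∫⁻ z in symbolCube n N,
        ‖σ (z.1 + latticePoint l, fun j => z.2 j + latticePoint (μ j))‖ₑ *
          (H (z.1 + latticePoint l) (-(∑ j, (z.2 j + latticePoint (μ j)))) *
            ∏ j, ‖g j (z.2 j + latticePoint (μ j))‖ₑ) ≤
      ENNReal.ofReal cW * U * (ENNReal.ofReal (W fun j => latticePoint (μ j)) *
        A₀ l (∑ j, μ j) * ∏ j, A j (μ j)) := by
    intro l μ
    refine (lintegral_symbolCube_le hσ.enorm hHcont hSm (fun x κ t ht =>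
      le_iSup_of_le (⟨t, mem_closedBall_zero_iff.2 ht⟩ : Metric.closedBall (0 : Rn n) (N * n))
        le_rfl) (fun j => (g j).continuous.enorm) l μ).trans ?_
    calc _ ≤ (ENNReal.ofReal cW * ENNReal.ofReal (W fun j => latticePoint (μ j)) * U) *
          (A₀ l (∑ j, μ j) * ∏ j, A j (μ j)) :=
          mul_le_mul_left (lintegral_sq_symbolCube_le hW.2.1 hcW hcW' σ l μ) _
      _ = _ := by ring
  have hAsum : ∀ j, ∑' κ, A j κ ^ 2 = ENNReal.ofReal cP * ∫⁻ x, ‖F j x‖ₑ ^ 2 := by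
    intro j
    simp only [hA, sq_rpow_half]
    rw [← lintegral_eq_tsum_unitCube (fun ξ => ‖g j ξ‖ₑ ^ 2)]
    simp only [← hg]
    exact hP (F j)
  have hL2 : ∀ h : 𝓢(Rn n, ℂ), ∫⁻ x, ‖h x‖ₑ ^ 2 ≠ ∞ := by
    intro h
    have := (h.memLp 2).2.ne
    rw [eLpNorm_two_eq] at this
    intro h0
    rw [h0] at this
    simp at this
  -- For each `x`, the function `z ↦ Φ(z - x) G(z)` is supported in the ball of radius `ρ` about
  -- `a`, so the sampling bound applies uniformly. Tonelli then leaves the `L²` norm of the kernel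
  -- over a cube, with `z` replaced by `a` in the weight at the cost of `D`.
  have hA₀sum : ∀ l, ∑' κ, A₀ l κ ^ 2 ≤ cS * cK * D ^ 2 * ENNReal.ofReal (R₀ ^ n) *
      weight (latticePoint l + -a) ^ 2 * ∫⁻ x, ‖G x‖ₑ ^ 2 := by
    intro l
    simp only [hA₀, sq_rpow_half]
    have hm : ∀ κ, AEMeasurable (fun x => S (x + latticePoint l) κ ^ 2)
        (volume.restrict (unitCube n)) := fun κ =>
      (((hSm κ).comp (measurable_add_const _)).pow_const 2).aemeasurable
    rw [← lintegral_tsum hm]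
    calc _ ≤ ∫⁻ x in unitCube n, cS *
          ∫⁻ z, ‖Φ (z - (x + latticePoint l)) * G z‖ₑ ^ 2 := by
          refine lintegral_mono fun x => ?_
          obtain ⟨h, hh⟩ := exists_schwartz_eq_mul_translate Φ G (x + latticePoint l)
          have := hS a h (fun z hz => hG z (fun h0 => hz (by rw [hh, h0, mul_zero])))
          simp only [hh] at this
          exact this
      _ = cS * ∫⁻ z, (∫⁻ x in unitCube n, ‖Φ (z - (x + latticePoint l))‖ₑ ^ 2) * ‖G z‖ₑ ^ 2 := by
          rw [lintegral_const_mul' _ _ hcS, lintegral_lintegral_swap]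
          · congr 2; ext z
            rw [← lintegral_mul_const' _ _ (by finiteness)]
            simp only [enorm_mul, mul_pow]
          · refine Continuous.aemeasurable ?_
            have := Φ.continuous
            have := G.continuous
            simp only [Function.uncurry_def]
            fun_prop
      _ ≤ cS * ∫⁻ z, (cK * ENNReal.ofReal (R₀ ^ n) *
            (D * weight (latticePoint l + -a)) ^ 2) * ‖G z‖ₑ ^ 2 := by
          refine mul_le_mul_right (lintegral_mono fun z => ?_) _
          by_cases hz : G z = 0
          · simp [hz]
          refine mul_le_mul_left ((hΦ2 z l).trans ?_) _
          gcongr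
          refine weight_le ?_
          have : latticePoint l - z - (latticePoint l + -a) = a - z := by abel
          rw [this, norm_sub_rev]
          exact hG z hz
      _ = _ := by
          have := weight_ne_top (latticePoint l + -a)
          rw [lintegral_const_mul' _ _ (by finiteness)]
          ring
  calc _ = ∑' (l : Zn n) (μ : Fin N → Zn n), ∫⁻ z in symbolCube n N,
        ‖σ (z.1 + latticePoint l, fun j => z.2 j + latticePoint (μ j))‖ₑ *
          (H (z.1 + latticePoint l) (-(∑ j, (z.2 j + latticePoint (μ j)))) *
            ∏ j, ‖g j (z.2 j + latticePoint (μ j))‖ₑ) := by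
        rw [lintegral_eq_tsum_symbolCube]
        simp only [hg, hH]
    _ ≤ ∑' (l : Zn n) (μ : Fin N → Zn n), ENNReal.ofReal cW * U *
        (ENNReal.ofReal (W fun j => latticePoint (μ j)) * A₀ l (∑ j, μ j) * ∏ j, A j (μ j)) :=
        ENNReal.tsum_le_tsum fun l => ENNReal.tsum_le_tsum fun μ => hcell l μ
    _ ≤ ∑' l : Zn n, ENNReal.ofReal cW * U * (cB * ((∑' κ, A₀ l κ ^ 2) ^ (1 / 2 : ℝ) *
          ∏ j, (∑' κ, A j κ ^ 2) ^ (1 / 2 : ℝ))) := by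
        refine ENNReal.tsum_le_tsum fun l => ?_
        rw [ENNReal.tsum_mul_left]
        refine mul_le_mul_right (hB (A₀ l) A (ne_top_of_le_ne_top ?_ (hA₀sum l)) fun j => ?_) _
        · have := weight_ne_top (latticePoint l + -a)
          have := hL2 G
          finiteness
        · rw [hAsum]
          have := hL2 (F j)
          finiteness
    _ ≤ ∑' l : Zn n, ENNReal.ofReal cW * U * (cB * (((cS * cK * D ^ 2) ^ (1 / 2 : ℝ) *
          ENNReal.ofReal (R₀ ^ ((n : ℝ) / 2)) * weight (latticePoint l + -a) * eLpNorm G 2) *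
          ((ENNReal.ofReal cP ^ (1 / 2 : ℝ)) ^ N * ∏ j, eLpNorm (F j) 2))) := by
        refine ENNReal.tsum_le_tsum fun l => ?_
        gcongr
        · refine (ENNReal.rpow_le_rpow (hA₀sum l) hhalf).trans (le_of_eq ?_)
          rw [ENNReal.mul_rpow_of_nonneg _ _ hhalf, ENNReal.mul_rpow_of_nonneg _ _ hhalf,
            ENNReal.mul_rpow_of_nonneg _ _ hhalf, rpow_half_sq, eLpNorm_two_eq,
            ENNReal.ofReal_rpow_of_nonneg (by positivity) hhalf, ← Real.rpow_natCast,
            ← Real.rpow_mul (by positivity), mul_one_div]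
        · refine le_of_eq ?_
          simp only [hAsum, ENNReal.mul_rpow_of_nonneg _ _ hhalf, Finset.prod_mul_distrib,
            Finset.prod_const, Finset.card_univ, Fintype.card_fin, eLpNorm_two_eq]
    _ = (ENNReal.ofReal cW * cB * (cS * cK * D ^ 2) ^ (1 / 2 : ℝ) *
          (ENNReal.ofReal cP ^ (1 / 2 : ℝ)) ^ N * ENNReal.ofReal (R₀ ^ ((n : ℝ) / 2)) * U *
          (∏ j, eLpNorm (F j) 2) * eLpNorm G 2) * ∑' l : Zn n, weight (latticePoint l + -a) := by
        rw [← ENNReal.tsum_mul_left]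
        refine tsum_congr fun l => ?_
        ring
    _ ≤ (ENNReal.ofReal cW * cB * (cS * cK * D ^ 2) ^ (1 / 2 : ℝ) *
          (ENNReal.ofReal cP ^ (1 / 2 : ℝ)) ^ N * ENNReal.ofReal (R₀ ^ ((n : ℝ) / 2)) * U *
          (∏ j, eLpNorm (F j) 2) * eLpNorm G 2) * cL := by
        gcongr
        exact hL (-a)
    _ = _ := by ring

end LocalEstimate

end

/-! ### Sequence space inequalities -/

noncomputable section

section SequenceSpaces

theorem lqNorm_top {ι : Type*} (a : ι → ℝ≥0∞) : lqNorm ∞ a = ⨆ k, a k := if_pos rfl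

theorem lqNorm_of_ne_top {ι : Type*} {q : ℝ≥0∞} (hq : q ≠ ∞) (a : ι → ℝ≥0∞) :
    lqNorm q a = (∑' k, a k ^ q.toReal) ^ (1 / q.toReal) := if_neg hq

theorem lqNorm_mono {ι : Type*} (q : ℝ≥0∞) {a b : ι → ℝ≥0∞} (h : ∀ k, a k ≤ b k) :
    lqNorm q a ≤ lqNorm q b := by
  unfold lqNorm
  split_ifs
  · exact iSup_mono h
  · refine ENNReal.rpow_le_rpow (ENNReal.tsum_le_tsum fun k => ?_) (by positivity)
    exact ENNReal.rpow_le_rpow (h k) (by positivity)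

theorem lqNorm_const_mul {ι : Type*} {q : ℝ≥0∞} (hq : 0 < q) (c : ℝ≥0∞) (a : ι → ℝ≥0∞) :
    lqNorm q (fun k => c * a k) = c * lqNorm q a := by
  unfold lqNorm
  split_ifs with h
  · rw [ENNReal.mul_iSup]
  · have hp : 0 < q.toReal := ENNReal.toReal_pos hq.ne' h
    simp only [ENNReal.mul_rpow_of_nonneg _ _ hp.le]
    rw [ENNReal.tsum_mul_left, ENNReal.mul_rpow_of_nonneg _ _ (by positivity),
      ← ENNReal.rpow_mul, mul_one_div_cancel hp.ne', ENNReal.rpow_one]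

/-- Hölder's inequality. -/
theorem lqNorm_prod_le {ι : Type*} [Countable ι] {N : ℕ} {q : Fin N → ℝ≥0∞} {r : ℝ≥0∞}
    (hq : ∀ j, 0 < q j) (hr : 0 < r) (hqr : ∑ j, (q j)⁻¹ = r⁻¹) (D : Fin N → ι → ℝ≥0∞) :
    lqNorm r (fun k => ∏ j, D j k) ≤ ∏ j, lqNorm (q j) (D j) := by
  classical
  by_cases hrt : r = ∞
  · subst hrt
    have : ∀ j, q j = ∞ := by
      intro j
      rw [ENNReal.inv_top, Finset.sum_eq_zero_iff] at hqr
      exact ENNReal.inv_eq_zero.1 (hqr j (Finset.mem_univ j))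
    simp only [this, lqNorm_top]
    exact iSup_le fun k => Finset.prod_le_prod' fun j _ => le_iSup (D j) k
  set p := r.toReal with hp
  have hp0 : 0 < p := ENNReal.toReal_pos hr.ne' hrt
  -- Indices with `q j = ∞` are bounded by suprema. For the remaining ones the exponents `p / q_j`
  -- sum to `1`, as the weighted Hölder inequality requires.
  set s : Finset (Fin N) := Finset.univ.filter fun j => q j ≠ ∞ with hs
  have hqp : ∀ j ∈ s, 0 < (q j).toReal := fun j hj =>
    ENNReal.toReal_pos (hq j).ne' (by simpa [hs] using hj)
  have hsum : ∑ j ∈ s, p / (q j).toReal = 1 := by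
    have h1 : ∑ j ∈ s, (q j).toReal⁻¹ = p⁻¹ := by
      have h2 := congrArg ENNReal.toReal hqr
      rw [ENNReal.toReal_sum (fun j _ => ENNReal.inv_ne_top.2 (hq j).ne')] at h2
      simp only [ENNReal.toReal_inv] at h2
      rw [← h2, hs, Finset.sum_filter]
      refine Finset.sum_congr rfl fun j _ => ?_
      by_cases h : q j = ∞ <;> simp [h]
    simp only [div_eq_mul_inv]
    rw [← Finset.mul_sum, h1, mul_inv_cancel₀ hp0.ne']
  have hsplit : ∀ f : Fin N → ℝ≥0∞, ∏ j, f j = (∏ j ∈ s, f j) * ∏ j ∈ sᶜ, f j := fun f =>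
    (Finset.prod_mul_prod_compl s f).symm
  have hcompl : ∀ j ∈ sᶜ, q j = ∞ := fun j hj => by simpa [hs] using hj
  have hholder : ∑' k, (∏ j ∈ s, D j k) ^ p ≤
      ∏ j ∈ s, (∑' k, D j k ^ (q j).toReal) ^ (p / (q j).toReal) := by
    let _ : MeasurableSpace ι := ⊤
    have := ENNReal.lintegral_prod_norm_pow_le (μ := (Measure.count : Measure ι)) s
      (f := fun j k => D j k ^ (q j).toReal) (fun j _ => (measurable_of_countable _).aemeasurable)
      hsum (fun j hj => (div_pos hp0 (hqp j hj)).le)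
    simp only [lintegral_count] at this
    refine le_trans (le_of_eq (tsum_congr fun k => ?_)) this
    rw [← ENNReal.prod_rpow_of_nonneg hp0.le]
    refine Finset.prod_congr rfl fun j hj => ?_
    rw [← ENNReal.rpow_mul, mul_div_cancel₀ _ (hqp j hj).ne']
  have hfin : ∏ j, lqNorm (q j) (D j) = ((∏ j ∈ s, (∑' k, D j k ^ (q j).toReal) ^
      (p / (q j).toReal)) * (∏ j ∈ sᶜ, ⨆ k, D j k) ^ p) ^ (1 / p) := by
    rw [hsplit, ENNReal.mul_rpow_of_nonneg _ _ (by positivity), ← ENNReal.rpow_mul,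
      mul_one_div_cancel hp0.ne', ENNReal.rpow_one,
      ← ENNReal.prod_rpow_of_nonneg (by positivity : (0 : ℝ) ≤ 1 / p)]
    congr 1
    · refine Finset.prod_congr rfl fun j hj => ?_
      rw [lqNorm_of_ne_top (by simpa [hs] using hj), ← ENNReal.rpow_mul]
      congr 1
      field_simp
    · refine Finset.prod_congr rfl fun j hj => ?_
      rw [hcompl j hj, lqNorm_top]
  rw [hfin, lqNorm_of_ne_top hrt]
  refine ENNReal.rpow_le_rpow ?_ (by positivity)
  calc ∑' k, (∏ j, D j k) ^ p ≤ ∑' k, (∏ j ∈ s, D j k) ^ p * (∏ j ∈ sᶜ, ⨆ k, D j k) ^ p := by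
        refine ENNReal.tsum_le_tsum fun k => ?_
        rw [hsplit, ENNReal.mul_rpow_of_nonneg _ _ hp0.le]
        gcongr with j hj
        exact le_iSup (D j) k
    _ ≤ _ := by
        rw [ENNReal.tsum_mul_right]
        gcongr

theorem rpow_sum_le_sum_rpow {ι : Type*} (s : Finset ι) (f : ι → ℝ≥0∞) {p : ℝ} (hp : 0 < p)
    (hp1 : p ≤ 1) : (∑ i ∈ s, f i) ^ p ≤ ∑ i ∈ s, f i ^ p := by
  classical
  induction s using Finset.induction_on with
  | empty => simp [hp]
  | insert i s hi ih =>
    rw [Finset.sum_insert hi, Finset.sum_insert hi]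
    exact (ENNReal.rpow_add_le_add_rpow _ _ hp.le hp1).trans (by gcongr)

/-- For finite `q ≥ 2` this is convexity of `t ↦ t^{q/2}`, with cost `(|K|^{q/2-1} |K|)^{1/q} =
|K|^{1/2}`; for `q ≤ 2` it is subadditivity of the same power, with cost `|K|^{1/q}`. In both cases
each shift preserves the `ℓ^q` sum. -/
theorem lqNorm_le_of_sq_le_sum {G : Type*} [AddCommGroup G] {q : ℝ≥0∞} (hq : 0 < q)
    {K : Finset G} (hK : K.Nonempty) {D a : G → ℝ≥0∞} (h : ∀ ν, D ν ^ 2 ≤ ∑ k ∈ K, a (ν + k) ^ 2) :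
    lqNorm q D ≤ (K.card : ℝ≥0∞) ^ (1 / (min 2 q).toReal) * lqNorm q a := by
  have hD : ∀ ν, D ν ≤ (∑ k ∈ K, a (ν + k) ^ 2) ^ (1 / 2 : ℝ) := fun ν => by
    rw [← rpow_half_sq (D ν)]
    exact ENNReal.rpow_le_rpow (h ν) (by norm_num)
  have hK0 : (K.card : ℝ≥0∞) ≠ 0 := by simpa using hK.ne_empty
  have hKt : (K.card : ℝ≥0∞) ≠ ∞ := ENNReal.natCast_ne_top _
  by_cases hqt : q = ∞
  · subst hqt
    rw [min_eq_left le_top, lqNorm_top, lqNorm_top]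
    refine iSup_le fun ν => (hD ν).trans ?_
    calc (∑ k ∈ K, a (ν + k) ^ 2) ^ (1 / 2 : ℝ) ≤
          (∑ _k ∈ K, (⨆ k, a k) ^ 2) ^ (1 / 2 : ℝ) := by
          gcongr
          exact le_iSup a _
      _ = _ := by
          rw [Finset.sum_const, nsmul_eq_mul, ENNReal.mul_rpow_of_nonneg _ _ (by norm_num),
            rpow_half_sq]
          norm_num
  set p := q.toReal with hp
  have hp0 : 0 < p := ENNReal.toReal_pos hq.ne' hqt
  rw [lqNorm_of_ne_top hqt, lqNorm_of_ne_top hqt]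
  have hshift : ∑' ν, ∑ k ∈ K, a (ν + k) ^ p = K.card * ∑' ν, a ν ^ p := by
    rw [Summable.tsum_finsetSum fun _ _ => ENNReal.summable]
    have : ∀ k, ∑' ν, a (ν + k) ^ p = ∑' ν, a ν ^ p := fun k =>
      (Equiv.addRight k).tsum_eq (fun ν => a ν ^ p)
    simp [this]
  have hpow : ∀ x : ℝ≥0∞, (x ^ 2) ^ (p / 2) = x ^ p := fun x => by
    rw [← ENNReal.rpow_natCast, ← ENNReal.rpow_mul]
    congr 1
    push_cast
    ring
  have hDp : ∀ ν, D ν ^ p ≤ (∑ k ∈ K, a (ν + k) ^ 2) ^ (p / 2) := fun ν => by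
    rw [← hpow]
    exact ENNReal.rpow_le_rpow (h ν) (by positivity)
  rcases le_total 2 q with h2 | h2
  · have h2p : 2 ≤ p := by
      have := ENNReal.toReal_mono hqt h2
      simpa using this
    rw [min_eq_left h2]
    calc (∑' ν, D ν ^ p) ^ (1 / p) ≤
          ((K.card : ℝ≥0∞) ^ (p / 2 - 1) * (K.card * ∑' ν, a ν ^ p)) ^ (1 / p) := by
          refine ENNReal.rpow_le_rpow ?_ (by positivity)
          rw [← hshift, ← ENNReal.tsum_mul_left]
          refine ENNReal.tsum_le_tsum fun ν => (hDp ν).trans ?_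
          have := ENNReal.rpow_sum_le_const_mul_sum_rpow (s := K) (f := fun k => a (ν + k) ^ 2)
            (p := p / 2) (by linarith)
          simpa only [hpow] using this
      _ = _ := by
          rw [← mul_assoc, ENNReal.mul_rpow_of_nonneg _ _ (by positivity)]
          congr 1
          nth_rewrite 2 [← ENNReal.rpow_one (K.card : ℝ≥0∞)]
          rw [← ENNReal.rpow_add _ _ hK0 hKt, ← ENNReal.rpow_mul]
          congr 1
          simp only [ENNReal.toReal_ofNat]
          field_simp
          ring
  · have h2p : p ≤ 2 := by
      have := ENNReal.toReal_mono (by norm_num) h2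
      simpa using this
    rw [min_eq_right h2, ← ENNReal.mul_rpow_of_nonneg _ _ (by positivity), ← hshift]
    refine ENNReal.rpow_le_rpow (ENNReal.tsum_le_tsum fun ν => (hDp ν).trans ?_) (by positivity)
    refine (rpow_sum_le_sum_rpow K _ (by positivity) (by linarith)).trans (le_of_eq ?_)
    simp only [hpow]

end SequenceSpaces

end

/-! ### Duality, cutoffs and the operator bound -/

noncomputable section

section OperatorBounds

variable {n N : ℕ}

/-- The `L²` norm is determined by pairing with Schwartz functions. -/
theorem eLpNorm_two_le_of_forall_schwartz {h : Rn n → ℂ} (hh : MemLp h 2) {A : ℝ≥0∞}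
    (hA : ∀ g : 𝓢(Rn n, ℂ), ‖∫ x, g x * h x‖ₑ ≤ A * eLpNorm g 2) : eLpNorm h 2 ≤ A := by
  by_cases hAt : A = ∞
  · simp [hAt]
  -- Conjugation turns the sesquilinear inner product into the bilinear pairing with `h`. The bound
  -- extends from the dense Schwartz functions to all of `L²` and is then tested on `u` itself.
  have hh' : MemLp (fun x => starRingEnd ℂ (h x)) 2 := hh.star
  set u := hh'.toLp with hu
  have hnorm : ‖u‖ = (eLpNorm h 2).toReal := by
    rw [hu, Lp.norm_toLp]
    congr 1
    exact eLpNorm_congr_norm_ae (Filter.Eventually.of_forall fun x => by simp)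
  have hmain : ∀ v : Lp ℂ 2 (volume : Measure (Rn n)), ‖inner ℂ u v‖ ≤ A.toReal * ‖v‖ := by
    intro v
    refine DenseRange.induction_on (SchwartzMap.denseRange_toLpCLM (E := Rn n) (F := ℂ)
      (p := 2) (μ := volume) (by norm_num)) v ?_ fun g => ?_
    · exact isClosed_le (by fun_prop) (by fun_prop)
    · have h1 : inner ℂ u (SchwartzMap.toLpCLM ℝ ℂ 2 volume g) = ∫ x, g x * h x := by
        rw [L2.inner_def]
        refine integral_congr_ae ?_
        filter_upwards [hh'.coeFn_toLp, g.coeFn_toLp 2 volume] with x hx1 hx2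
        rw [hu, hx1, SchwartzMap.toLpCLM_apply, hx2]
        simp
      rw [h1, SchwartzMap.toLpCLM_apply, SchwartzMap.norm_toLp, ← ENNReal.toReal_mul,
        ← toReal_enorm]
      have hg : eLpNorm (fun x => g x) 2 volume ≠ ∞ := (g.memLp 2 volume).2.ne
      exact ENNReal.toReal_mono (ENNReal.mul_ne_top hAt hg) (hA g)
  have h2 := hmain u
  rw [inner_self_eq_norm_sq_to_K] at h2
  have h3 : ‖u‖ ≤ A.toReal := by
    rcases (norm_nonneg u).eq_or_lt with h0 | h0
    · rw [← h0]; exact ENNReal.toReal_nonneg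
    · rw [norm_pow, RCLike.norm_ofReal, abs_norm, sq] at h2
      exact le_of_mul_le_mul_right h2 h0
  rw [hnorm] at h3
  exact (ENNReal.toReal_le_toReal hh.2.ne hAt).1 h3

theorem continuous_multPsiDO {σ : SymbolSpace n N → ℂ} (hσ : Continuous σ)
    (hb : ∃ K : ℝ, ∀ z, ‖σ z‖ ≤ K) (f : Fin N → 𝓢(Rn n, ℂ)) :
    Continuous (multPsiDO σ f) ∧ ∃ K : ℝ, ∀ x, ‖multPsiDO σ f x‖ ≤ K := by
  choose g hg using fun j => exists_schwartz_eq_hat (f j)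
  obtain ⟨K, hK⟩ := hb
  have hgc : ∀ j, Continuous (g j) := fun j => (g j).continuous
  have hint : Integrable fun ξ : Fin N → Rn n => ∏ j, g j (ξ j) :=
    Integrable.fintype_prod fun j => (g j).integrable
  have hbound : ∀ (x : Rn n) (ξ : Fin N → Rn n),
      ‖Complex.exp (Complex.I * (inner ℝ x (∑ j, ξ j) : ℝ)) * σ (x, ξ) * ∏ j, g j (ξ j)‖ ≤
        K * ‖∏ j, g j (ξ j)‖ := by
    intro x ξ
    rw [norm_mul, norm_mul, norm_cexp_I, one_mul]
    gcongr
    exact hK _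
  unfold multPsiDO
  simp only [hg]
  refine ⟨continuous_const.mul ?_, ‖((1 / (2 * Real.pi) ^ (N * n) : ℝ) : ℂ)‖ *
    ∫ ξ : Fin N → Rn n, K * ‖∏ j, g j (ξ j)‖, fun x => ?_⟩
  · refine continuous_of_dominated (bound := fun ξ => K * ‖∏ j, g j (ξ j)‖) (fun x => ?_)
      (fun x => Filter.Eventually.of_forall (hbound x)) (hint.norm.const_mul K)
      (Filter.Eventually.of_forall fun ξ => ?_)
    · exact Continuous.aestronglyMeasurable (by fun_prop)
    · fun_prop
  · rw [norm_mul]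
    gcongr
    exact norm_integral_le_of_norm_le (hint.norm.const_mul K)
      (Filter.Eventually.of_forall (hbound x))

theorem exists_schwartz_eq_bump_mul {a : Rn n} (b : ContDiffBump a) (f : 𝓢(Rn n, ℂ)) :
    ∃ F : 𝓢(Rn n, ℂ), ∀ y, F y = (b y : ℂ) * f y := by
  have hbs : ContDiff ℝ (⊤ : ℕ∞) (fun z => ((b z : ℝ) : ℂ)) :=
    Complex.ofRealCLM.contDiff.comp b.contDiff
  have hbc : HasCompactSupport (fun z => ((b z : ℝ) : ℂ)) :=
    b.hasCompactSupport.comp_left (g := fun r : ℝ => (r : ℂ)) (by simp)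
  exact ⟨SchwartzMap.smulLeftCLM ℂ (fun z => ((b z : ℝ) : ℂ)) f, fun y => by
    rw [SchwartzMap.smulLeftCLM_apply_apply (hbc.hasTemperateGrowth hbs), smul_eq_mul]⟩

theorem enorm_bump_mul_le {a : Rn n} (b : ContDiffBump a) (y : Rn n) (c : ℂ) :
    ‖(b y : ℂ) * c‖ₑ ≤ ‖c‖ₑ := by
  rw [enorm_mul]
  refine mul_le_of_le_one_left zero_le ?_
  rw [← ofReal_norm, ENNReal.ofReal_le_one, Complex.norm_real, Real.norm_of_nonneg b.nonneg]
  exact b.le_one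

/-- A smooth cutoff to the ball of radius `R + n + 3`. -/
def cutoff (a : Rn n) (R : ℝ) (hR : 1 ≤ R) : ContDiffBump a :=
  ⟨R + n + 3, R + n + 4, by positivity, by linarith⟩

/-- Duality applied to `b · T_σ f`, where the bump `b` equals `1` on the cube at `ν`; the bump is
moved onto the test function, which makes it local. -/
theorem exists_eLpNorm_multPsiDO_le (n N : ℕ) {W : (Fin N → Rn n) → ℝ} (hW : IsModerate W)
    (hWB : ClassB (fun ν : Fin N → Zn n => W (fun j => latticePoint (ν j)))) :
    ∃ C : ℝ≥0∞, C ≠ ∞ ∧ ∀ (R₀ : ℝ) (R : Fin N → ℝ), 1 ≤ R₀ → ∀ hR : ∀ j, 1 ≤ R j,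
      ∀ σ : SymbolSpace n N → ℂ, Continuous σ → (∃ K : ℝ, ∀ z, ‖σ z‖ ≤ K) →
        Distribution.dsupport (fourierDistribution σ) ⊆ productBall R₀ R →
        ∀ (f : Fin N → 𝓢(Rn n, ℂ)) (ν : Zn n),
          eLpNorm (fun x => multPsiDO σ f (x + latticePoint ν)) 2
              (volume.restrict (unitCube n)) ≤
            C * ENNReal.ofReal (R₀ ^ ((n : ℝ) / 2)) *
              ulNorm (fun z : SymbolSpace n N => ((W z.2)⁻¹ : ℂ) * σ z) *
              ∏ j, eLpNorm (fun y => (cutoff (latticePoint ν) (R j) (hR j) y : ℂ) * f j y) 2 := by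
  obtain ⟨C, hC, h⟩ := exists_lintegral_mul_hat_le n N hW hWB (n + 2)
  refine ⟨C, hC, fun R₀ R hR₀ hR σ hσ hb hsupp f ν => ?_⟩
  obtain ⟨Φ, hΦ, hmain⟩ := h R₀ hR₀
  obtain ⟨hTc, K, hTb⟩ := continuous_multPsiDO hσ hb f
  choose F hF using fun j => exists_schwartz_eq_bump_mul (cutoff (latticePoint ν) (R j) (hR j)) (f j)
  -- The cube lies in the ball of radius `n`, where `b = 1`. With `b` supported in radius `n + 2`,
  -- the localization sees `f_j` only within `n + 2 + R_j + 1`, the inner radius of `cutoff`.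
  let b : ContDiffBump (latticePoint ν) := ⟨n + 1, n + 2, by positivity, by linarith⟩
  have hfF : ∀ j y, ‖y - latticePoint ν‖ < n + 2 + R j + 1 → f j y = F j y := by
    intro j y hy
    rw [hF, ContDiffBump.one_of_mem_closedBall]
    · simp
    · rw [mem_closedBall_iff_norm]
      change ‖y - latticePoint ν‖ ≤ R j + n + 3
      linarith
  have hbT : MemLp (fun x => (b x : ℂ) * multPsiDO σ f x) 2 := by
    have hbs : ContDiff ℝ (⊤ : ℕ∞) (fun z => ((b z : ℝ) : ℂ)) :=
      Complex.ofRealCLM.contDiff.comp b.contDiff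
    have hbc : HasCompactSupport (fun z => ((b z : ℝ) : ℂ)) :=
      b.hasCompactSupport.comp_left (g := fun r : ℝ => (r : ℂ)) (by simp)
    exact (hbs.continuous.mul hTc).memLp_of_hasCompactSupport hbc.mul_right
  have hdual : eLpNorm (fun x => (b x : ℂ) * multPsiDO σ f x) 2 ≤
      C * ENNReal.ofReal (R₀ ^ ((n : ℝ) / 2)) *
        ulNorm (fun z : SymbolSpace n N => ((W z.2)⁻¹ : ℂ) * σ z) * ∏ j, eLpNorm (F j) 2 := by
    refine eLpNorm_two_le_of_forall_schwartz hbT fun g => ?_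
    obtain ⟨G, hG⟩ := exists_schwartz_eq_bump_mul b g
    have hGs : ∀ x, G x ≠ 0 → ‖x - latticePoint ν‖ ≤ n + 2 := by
      intro x hx
      by_contra hcon
      push Not at hcon
      refine hx ?_
      rw [hG, b.zero_of_le_dist (by rw [dist_eq_norm]; exact hcon.le)]
      simp
    have h1 : ∫ x, g x * ((b x : ℂ) * multPsiDO σ f x) = ∫ x, G x * multPsiDO σ f x := by
      congr 1; ext x; rw [hG]; ring
    rw [h1]
    refine (enorm_integral_mul_multPsiDO_le hσ hb hsupp Φ hΦ G _ _ hGs f F hfF).trans ?_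
    refine (hmain σ hσ _ G hGs F).trans ?_
    gcongr
    refine eLpNorm_mono_enorm fun x => ?_
    rw [hG]
    exact enorm_bump_mul_le b x _
  have hFeq : ∀ j, (F j : Rn n → ℂ) =
      fun y => (cutoff (latticePoint ν) (R j) (hR j) y : ℂ) * f j y := fun j => funext (hF j)
  simp only [← hFeq]
  refine le_trans ?_ hdual
  rw [eLpNorm_two_eq, eLpNorm_two_eq]
  refine ENNReal.rpow_le_rpow ?_ (by norm_num)
  rw [← lintegral_add_right_eq_self (fun x => ‖(b x : ℂ) * multPsiDO σ f x‖ₑ ^ 2) (latticePoint ν)]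
  refine le_trans (setLIntegral_mono' (measurableSet_unitCube n) fun x hx => ?_)
    (lintegral_mono' Measure.restrict_le_self le_rfl)
  rw [b.one_of_mem_closedBall]
  · simp
  · rw [mem_closedBall_iff_norm, add_sub_cancel_right]
    change ‖x‖ ≤ n + 1
    linarith [norm_le_of_mem_unitCube hx]

theorem abs_le_norm_latticePoint (ν : Zn n) (i : Fin n) : |(ν i : ℝ)| ≤ ‖latticePoint ν‖ :=
  PiLp.norm_apply_le (latticePoint ν) i

theorem latticePoint_add (ν μ : Zn n) : latticePoint (ν + μ) = latticePoint ν + latticePoint μ := by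
  ext i
  simp [latticePoint]

/-- The cutoff around `ν` meets only cubes whose index differs from `ν` by an element of a box `K`
with at most a constant times `R^n` points; the sum over `K` costs `|K|^{1/min(2,q)}`. -/
theorem lqNorm_cutoff_le {q : ℝ≥0∞} (hq : 0 < q) {R : ℝ} (hR : 1 ≤ R) (f : 𝓢(Rn n, ℂ)) :
    lqNorm q (fun ν : Zn n => eLpNorm (fun y => (cutoff (latticePoint ν) R hR y : ℂ) * f y) 2) ≤
      ENNReal.ofReal (((4 * n + 13 : ℝ) ^ n) ^ (1 / (min 2 q).toReal) *
        R ^ ((n : ℝ) / (min 2 q).toReal)) * amalgamNorm 2 q f := by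
  -- The outer radius `R + n + 4` of the cutoff plus the bound `n` for points of the cube. Since `R
  -- ≥ 1`, `2L + 1 ≤ 4n + 11 + 2R ≤ (4n + 13) R`.
  set L : ℕ := ⌈2 * n + 4 + R⌉₊ with hL
  set K : Finset (Zn n) := Fintype.piFinset fun _ : Fin n => Finset.Icc (-(L : ℤ)) L with hK
  have hKn : K.Nonempty := ⟨0, by simp [hK]⟩
  have hcard : (K.card : ℝ) ≤ (4 * n + 13) ^ n * R ^ n := by
    have h1 : K.card = (2 * L + 1) ^ n := by
      rw [hK, Fintype.card_piFinset]
      simp only [Int.card_Icc, Finset.prod_const, Finset.card_univ, Fintype.card_fin]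
      congr 1
      omega
    rw [h1, ← mul_pow]
    push_cast
    have h2 : (L : ℝ) < 2 * n + 4 + R + 1 := Nat.ceil_lt_add_one (by positivity)
    gcongr
    have hn0 : (0 : ℝ) ≤ n := by positivity
    nlinarith
  have hsq : ∀ ν : Zn n, eLpNorm (fun y => (cutoff (latticePoint ν) R hR y : ℂ) * f y) 2 ^ 2 ≤
      ∑ k ∈ K, eLpNorm (fun x => f (x + latticePoint (ν + k))) 2
        (volume.restrict (unitCube n)) ^ 2 := by
    intro ν
    simp only [eLpNorm_two_eq, sq_rpow_half]
    rw [lintegral_eq_tsum_unitCube, ← (Equiv.addLeft ν).tsum_eq]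
    simp only [Equiv.coe_addLeft]
    rw [tsum_eq_sum (s := K)]
    · refine Finset.sum_le_sum fun k _ => lintegral_mono fun x => ?_
      gcongr
      exact enorm_bump_mul_le _ _ _
    · intro k hk
      rw [setLIntegral_congr_fun (g := fun _ => 0) (measurableSet_unitCube n), lintegral_zero]
      intro x hx
      have hz : cutoff (latticePoint ν) R hR (x + latticePoint (ν + k)) = 0 := by
        refine ContDiffBump.zero_of_le_dist _ ?_
        change R + n + 4 ≤ _
        have h3 : x + latticePoint (ν + k) - latticePoint ν = latticePoint k + x := by
          rw [latticePoint_add]; abel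
        rw [dist_eq_norm, h3]
        have h4 : ∃ i, (L : ℝ) < |(k i : ℝ)| := by
          by_contra hcon
          push Not at hcon
          refine hk ?_
          rw [hK, Fintype.mem_piFinset]
          intro i
          have := abs_le.1 (hcon i)
          rw [Finset.mem_Icc]
          exact ⟨by exact_mod_cast this.1, by exact_mod_cast this.2⟩
        obtain ⟨i, hi⟩ := h4
        have h5 := abs_le_norm_latticePoint k i
        have h6 : 2 * n + 4 + R ≤ L := Nat.le_ceil _
        have h7 : ‖latticePoint k‖ ≤ ‖latticePoint k + x‖ + ‖x‖ := by
          simpa using norm_sub_le (latticePoint k + x) x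
        linarith [norm_le_of_mem_unitCube hx]
      simp [hz]
  refine (lqNorm_le_of_sq_le_sum hq hKn (a := fun μ : Zn n =>
    eLpNorm (fun x => f (x + latticePoint μ)) 2 (volume.restrict (unitCube n))) hsq).trans ?_
  rw [amalgamNorm]
  gcongr
  have hm : (0 : ℝ) ≤ 1 / (min 2 q).toReal := by positivity
  calc (K.card : ℝ≥0∞) ^ (1 / (min 2 q).toReal) ≤
        ENNReal.ofReal ((4 * n + 13) ^ n * R ^ n) ^ (1 / (min 2 q).toReal) := by
        gcongr
        rw [← ENNReal.ofReal_natCast]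
        exact ENNReal.ofReal_le_ofReal hcard
    _ = _ := by
        rw [ENNReal.ofReal_rpow_of_nonneg (by positivity) hm,
          Real.mul_rpow (by positivity) (by positivity), ← Real.rpow_natCast R n,
          ← Real.rpow_mul (by positivity), mul_one_div]

end OperatorBounds

theorem lqNorm_prod_cutoff_le {N : ℕ} {q : Fin N → ℝ≥0∞} {r : ℝ≥0∞} (hq : ∀ j, 0 < q j)
    (hr : 0 < r) (hqr : ∑ j, (q j)⁻¹ = r⁻¹) {R : Fin N → ℝ} (hR : ∀ j, 1 ≤ R j)
    (f : Fin N → 𝓢(Rn n, ℂ)) :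
    lqNorm r (fun ν : Zn n => ∏ j,
        eLpNorm (fun y => (cutoff (latticePoint ν) (R j) (hR j) y : ℂ) * f j y) 2) ≤
      ∏ j, (ENNReal.ofReal (((4 * n + 13 : ℝ) ^ n) ^ (1 / (min 2 (q j)).toReal) *
        R j ^ ((n : ℝ) / (min 2 (q j)).toReal)) * amalgamNorm 2 (q j) (f j)) := by
  have hD : ∀ j, _ := fun j => lqNorm_cutoff_le (hq j) (hR j) (f j)
  have h1 := lqNorm_prod_le hq hr hqr (fun j (ν : Zn n) =>
    eLpNorm (fun y => (cutoff (latticePoint ν) (R j) (hR j) y : ℂ) * f j y) 2)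
  refine h1.trans ?_
  exact Finset.prod_le_prod' fun j _ => hD j

theorem ofReal_mul_prod_eq {ι : Type*} [Fintype ι] {c d : ℝ} {a b : ι → ℝ} (hc : 0 ≤ c)
    (hd : 0 ≤ d) (ha : ∀ j, 0 ≤ a j) (hb : ∀ j, 0 ≤ b j) (U : ℝ≥0∞) (X : ι → ℝ≥0∞) :
    ENNReal.ofReal c * ENNReal.ofReal d * U * ∏ j, (ENNReal.ofReal (a j * b j) * X j) =
      ENNReal.ofReal (c * (∏ j, a j) * d * ∏ j, b j) * U * ∏ j, X j := by
  have hA : 0 ≤ ∏ j, a j := Finset.prod_nonneg fun j _ => ha j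
  rw [Finset.prod_mul_distrib,
    ← ENNReal.ofReal_prod_of_nonneg fun j _ => mul_nonneg (ha j) (hb j),
    Finset.prod_mul_distrib, mul_right_comm c, mul_assoc (c * d),
    ENNReal.ofReal_mul (mul_nonneg hc hd), ENNReal.ofReal_mul hc]
  ring

end

/-- The constant `C` depends only on `n`, `N`, `W`, the `q_j` and `r`. -/
theorem proposition5p1 (n N : ℕ) (hn : 0 < n) (hN : 0 < N)
    (W : (Fin N → Rn n) → ℝ) (hW : IsModerate W)
    (hWB : ClassB (fun ν : Fin N → Zn n => W (fun j => latticePoint (ν j))))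
    (q : Fin N → ℝ≥0∞) (r : ℝ≥0∞) (hq : ∀ j, 0 < q j) (hr : 0 < r)
    (hqr : ∑ j, (q j)⁻¹ = r⁻¹) :
    ∃ C : ℝ, 0 < C ∧
      ∀ (R₀ : ℝ) (R : Fin N → ℝ), 1 ≤ R₀ → (∀ j, 1 ≤ R j) →
      ∀ σ : SymbolSpace n N → ℂ, Continuous σ → (∃ K : ℝ, ∀ z, ‖σ z‖ ≤ K) →
        Distribution.dsupport (fourierDistribution σ) ⊆ productBall R₀ R →
        multOpNorm (fun j => amalgamNorm 2 (q j)) (amalgamNorm 2 r) (multPsiDO σ) ≤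
          ENNReal.ofReal
            (C * R₀ ^ ((n : ℝ) / 2) * ∏ j, R j ^ ((n : ℝ) / (min 2 (q j)).toReal)) *
          ulNorm (fun z : SymbolSpace n N => ((W z.2)⁻¹ : ℂ) * σ z) := by
  obtain ⟨C, hC, h⟩ := exists_eLpNorm_multPsiDO_le n N hW hWB
  set P : ℝ := ∏ j, ((4 * n + 13 : ℝ) ^ n) ^ (1 / (min 2 (q j)).toReal) with hP
  have hP0 : 0 < P := Finset.prod_pos fun j _ => by positivity
  -- `P` collects the cube-counting constants of the `N` cutoffs, and the `+ 1` keeps the constant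
  -- strictly positive. It remains to show that the right-hand side is an admissible bound.
  refine ⟨(C.toReal + 1) * P, by positivity, fun R₀ R hR₀ hR σ hσ hb hsupp => sInf_le ?_⟩
  intro f _
  have hR' : ∀ j, 0 < R j := fun j => by linarith [hR j]
  set U := ulNorm (fun z : SymbolSpace n N => ((W z.2)⁻¹ : ℂ) * σ z)
  have hC' : C ≤ ENNReal.ofReal (C.toReal + 1) := by
    rw [ENNReal.le_ofReal_iff_toReal_le hC (by positivity)]
    linarith
  have hT : amalgamNorm 2 r (multPsiDO σ f) ≤
      (C * ENNReal.ofReal (R₀ ^ ((n : ℝ) / 2)) * U) * lqNorm r (fun ν : Zn n => ∏ j,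
        eLpNorm (fun y => (cutoff (latticePoint ν) (R j) (hR j) y : ℂ) * f j y) 2) := by
    have h1 : ∀ ν : Zn n, _ := fun ν => h R₀ R hR₀ hR σ hσ hb hsupp f ν
    rw [amalgamNorm]
    exact (lqNorm_mono r h1).trans_eq (lqNorm_const_mul hr _ _)
  have hF := lqNorm_prod_cutoff_le hq hr hqr hR f
  refine (hT.trans (mul_le_mul' (mul_le_mul_left (mul_le_mul_left hC' _) _) hF)).trans ?_
  exact (ofReal_mul_prod_eq (by positivity) (by positivity) (fun j => by positivity)
    (fun j => Real.rpow_nonneg (hR' j).le _) U _).le
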